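/- Let $n, p$ be integers with $n \ge 0$ and $p \ge n+2$, let $\sigma \ge 0$, and let $w_1^*, w_2^* \in \mathbb{R}^p$ be the ground-truth parameters of two linear regression tasks. For $t = 1, 2$ let the training data of task $t$ be $(X_t, y_t)$ with $X_t \in \mathbb{R}^{p \times n}$ and $y_t = X_t^\top w_t^* + z_t \in \mathbb{R}^n$, where all entries of $X_1, X_2$ are $\mathcal{N}(0,1)$, all entries of the noise vectors $z_1, z_2 \in \mathbb{R}^n$ are $\mathcal{N}(0,\sigma^2)$, and all these random variables are jointly independent. The tasks are learned one after the other: $w_0 = 0$, and for $t = 1, 2$ the learned model $w_t$ is the (almost surely existing and unique) solution of $$\min_{w \in \mathbb{R}^p} \|w - w_{t-1}\|_2 \quad \text{subject to} \quad X_t^\top w = y_t .$$ Let $\mathcal{L}_1(w) = \|w - w_1^*\|^2$ be the model error for task 1, and let $F_2 = \mathcal{L}_1(w_2) - \mathcal{L}_1(w_1)$ be the forgetting of task 1 after learning task 2. Suppose that $$\sigma^2 < \frac{p-n-1}{p}\,\|w_1^*\|^2 .$$ If $$2\langle w_1^*, w_2^* \rangle \ \ge\ \frac{n}{p}\|w_1^*\|^2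 + \|w_2^*\|^2 + \frac{(p-n)\sigma^2}{p-n-1},$$ then $F_2$ is integrable and $\mathbb{E}[F_2] \le 0$; that is, learning task 2 does not worsen, in expectation, the model for task 1 (backward transfer). -/

import Mathlib

open MeasureTheory ProbabilityTheory
open scoped Matrix NNReal

namespace ContinualLearning

/-- `v` solves the problem: minimize `‖w - u‖₂` over all `w` subject to `Xᵀ w = y`. -/
structure IsMinChangeSolution {p n : ℕ} (X : Matrix (Fin p) (Fin n) ℝ) (y : Fin n → ℝ)
    (u v : EuclideanSpace ℝ (Fin p)) : Prop where
  fits : Xᵀ *ᵥ v.ofLp = y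
  minimal : ∀ w : EuclideanSpace ℝ (Fin p), Xᵀ *ᵥ w.ofLp = y → ‖v - u‖ ≤ ‖w - u‖

/-- The minimizer is unique, so that the choice in `trainStep` is no real choice. -/
theorem IsMinChangeSolution.unique {p n : ℕ} {X : Matrix (Fin p) (Fin n) ℝ} {y : Fin n → ℝ}
    {u v v' : EuclideanSpace ℝ (Fin p)} (h : IsMinChangeSolution X y u v)
    (h' : IsMinChangeSolution X y u v') : v = v' := by
  have hm : Xᵀ *ᵥ ((1 / 2 : ℝ) • (v + v')).ofLp = y := by
    rw [WithLp.ofLp_smul, WithLp.ofLp_add, Matrix.mulVec_smul, Matrix.mulVec_add, h.fits, h'.fits]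
    ext i
    simp only [Pi.smul_apply, Pi.add_apply, smul_eq_mul]
    ring
  have h1 := h.minimal _ hm
  have h2 := h'.minimal _ hm
  have h3 := parallelogram_law_with_norm ℝ (v - u) (v' - u)
  have e1 : v - u + (v' - u) = (2 : ℝ) • ((1 / 2 : ℝ) • (v + v') - u) := by module
  have e2 : v - u - (v' - u) = v - v' := by abel
  rw [e1, e2, norm_smul, Real.norm_ofNat] at h3
  have a1 : ‖v - u‖ * ‖v - u‖ ≤ ‖(1 / 2 : ℝ) • (v + v') - u‖ * ‖(1 / 2 : ℝ) • (v + v') - u‖ :=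
    mul_self_le_mul_self (norm_nonneg _) h1
  have a2 : ‖v' - u‖ * ‖v' - u‖ ≤ ‖(1 / 2 : ℝ) • (v + v') - u‖ * ‖(1 / 2 : ℝ) • (v + v') - u‖ :=
    mul_self_le_mul_self (norm_nonneg _) h2
  have h4 : ‖v - v'‖ * ‖v - v'‖ = 0 :=
    le_antisymm (by nlinarith) (mul_self_nonneg _)
  exact sub_eq_zero.mp (norm_eq_zero.mp (mul_self_eq_zero.mp h4))

open Classical in
/-- One round of training from the initial point `u` on the data `(X, y)`: the interpolating
parameter vector closest to `u`. If `Xᵀ w = y` has no solution (a null event for Gaussian `X`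
when `n ≤ p`), the parameters are left unchanged. -/
noncomputable def trainStep {p n : ℕ} (X : Matrix (Fin p) (Fin n) ℝ) (y : Fin n → ℝ)
    (u : EuclideanSpace ℝ (Fin p)) : EuclideanSpace ℝ (Fin p) :=
  if h : ∃ v, IsMinChangeSolution X y u v then h.choose else u

/-- The training outputs `y = Xᵀ w* + z`. -/
noncomputable def output {p n : ℕ} (X : Matrix (Fin p) (Fin n) ℝ)
    (wstar : EuclideanSpace ℝ (Fin p)) (z : Fin n → ℝ) : Fin n → ℝ :=
  Xᵀ *ᵥ wstar.ofLp + z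

/-- The model `w_t` after training on tasks `1, …, t` in this order, started from `w_0 = 0`.
Tasks are numbered from `1`; the data with index `0` is not used. -/
noncomputable def model {p n : ℕ} (wstar : ℕ → EuclideanSpace ℝ (Fin p))
    (X : ℕ → Matrix (Fin p) (Fin n) ℝ) (z : ℕ → Fin n → ℝ) : ℕ → EuclideanSpace ℝ (Fin p)
  | 0 => 0
  | t + 1 => trainStep (X (t + 1)) (output (X (t + 1)) (wstar (t + 1)) (z (t + 1)))
      (model wstar X z t)

/-- The model error `‖w - w*‖²` of `w` for a task with ground truth `w*`. -/
noncomputable def modelError {p : ℕ} (wstar w : EuclideanSpace ℝ (Fin p)) : ℝ :=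
  ‖w - wstar‖ ^ 2

/-- The forgetting `F_t = (t - 1)⁻¹ ∑_{i=1}^{t-1} (L_i(w_t) - L_i(w_i))`, for `t ≥ 2`. -/
noncomputable def forgetting {p n : ℕ} (wstar : ℕ → EuclideanSpace ℝ (Fin p))
    (X : ℕ → Matrix (Fin p) (Fin n) ℝ) (z : ℕ → Fin n → ℝ) (t : ℕ) : ℝ :=
  1 / ((t : ℝ) - 1) * ∑ i ∈ Finset.Icc 1 (t - 1),
    (modelError (wstar i) (model wstar X z t) - modelError (wstar i) (model wstar X z i))

/-- The features and the noise of the tasks `1, …, T`: every entry of every `X t` is standard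
Gaussian, every entry of every `z t` is centred Gaussian with variance `σ²`, and all these
real random variables are jointly independent. -/
structure IsGaussianData {Ω : Type*} [MeasurableSpace Ω] (P : Measure Ω) (T : ℕ) {p n : ℕ}
    (σ : ℝ≥0) (X : ℕ → Ω → Matrix (Fin p) (Fin n) ℝ) (z : ℕ → Ω → Fin n → ℝ) : Prop where
  law_features : ∀ t ∈ Finset.Icc 1 T, ∀ i j,
    HasLaw (fun ω => X t ω i j) (gaussianReal 0 1) P
  law_noise : ∀ t ∈ Finset.Icc 1 T, ∀ j, HasLaw (fun ω => z t ω j) (gaussianReal 0 (σ ^ 2)) P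
  indep : iIndepFun
    (fun (k : (Finset.Icc 1 T × Fin p × Fin n) ⊕ (Finset.Icc 1 T × Fin n)) (ω : Ω) =>
      match k with
      | Sum.inl (t, i, j) => X t ω i j
      | Sum.inr (t, j) => z t ω j) P

end ContinualLearning

/-! If `X` has full column rank, a training step is an explicit affine map. With `Π` the orthogonal
projection onto the column space of `X` and `A = (XᵀX)⁻¹`, the new error is the old error with its
`Π`-part replaced by the `Π`-part of the task shift plus `X A z`. Put `e = w₁ - w₁*`, `d = w₂* -
w₁*`, and let `Π`, `A` belong to task 2. By Pythagoras `F₂ = dᵀΠd - eᵀΠe + 2 dᵀX₂Az₂ + z₂ᵀAz₂`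
(`forgetting_two_eq`).

In expectation the cross term vanishes, since the noise is centred and independent of `X₂`.
Invariance of the Gaussian law under row sign changes and row permutations, with `tr Π = n`, gives
`E Π = (n/p) I` (`integral_colProj_apply`). With `K = E tr (XᵀX)⁻¹`, the noise term is `σ²K` and
`E‖e‖² = (1 - n/p)‖w₁*‖² + σ²K`. Hence `E F₂ = (n/p)(‖d‖² - (1 - n/p)‖w₁*‖²) + (1 - n/p)σ²K`. The
coefficient of `K` is nonnegative, so `K ≤ n/(p-n-1)` suffices, and the assumed lower bound on
`2⟨w₁*, w₂*⟩`, multiplied by `n/p`, finishes.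

The bound on `K` needs no Wishart density. Stein's identity is applied to the entries of `X A_ε`
with `A_ε = (XᵀX + ε)⁻¹`, where everything is bounded; summing over all entries gives `(p-n-1) E tr
A_ε ≤ n` (`mul_integral_trace_ridgeInv_le`). Fatou's lemma as `ε → 0` transfers this to `K`. Since
`tr A_ε` blows up at rank-deficient `X`, the same estimate shows that `X` has full column rank
almost surely. -/

namespace ContinualLearning

/-- The regularized inverse Gram matrix `(Xᵀ X + ε)⁻¹`; for `ε = 0` it is the inverse Gram matrix,
or zero if `X` does not have full column rank. -/
noncomputable def ridgeInv {p n : ℕ} (ε : ℝ) (X : Matrix (Fin p) (Fin n) ℝ) :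
    Matrix (Fin n) (Fin n) ℝ :=
  (Xᵀ * X + ε • (1 : Matrix (Fin n) (Fin n) ℝ))⁻¹

/-! ### Regularized inverse Gram matrix: bounds, traces and derivatives. -/

section Ridge

variable {p n : ℕ} {ε : ℝ}

theorem posDef_ridge (hε : 0 < ε) (X : Matrix (Fin p) (Fin n) ℝ) :
    (Xᵀ * X + ε • (1 : Matrix (Fin n) (Fin n) ℝ)).PosDef := by
  have h := Matrix.posSemidef_conjTranspose_mul_self X
  rw [Matrix.conjTranspose_eq_transpose_of_trivial] at h
  exact Matrix.PosDef.posSemidef_add h (Matrix.PosDef.one.smul hε)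

theorem isUnit_ridge (hε : 0 < ε) (X : Matrix (Fin p) (Fin n) ℝ) :
    IsUnit (Xᵀ * X + ε • (1 : Matrix (Fin n) (Fin n) ℝ)) :=
  (posDef_ridge hε X).isUnit

theorem ridgeInv_transpose (X : Matrix (Fin p) (Fin n) ℝ) : (ridgeInv ε X)ᵀ = ridgeInv ε X := by
  simp [ridgeInv, Matrix.transpose_nonsing_inv]

theorem ridge_mul_ridgeInv (hε : 0 < ε) (X : Matrix (Fin p) (Fin n) ℝ) :
    (Xᵀ * X + ε • (1 : Matrix (Fin n) (Fin n) ℝ)) * ridgeInv ε X = 1 :=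
  Matrix.mul_nonsing_inv _ ((Matrix.isUnit_iff_isUnit_det _).1 (isUnit_ridge hε X))

theorem gram_mul_ridgeInv (hε : 0 < ε) (X : Matrix (Fin p) (Fin n) ℝ) :
    Xᵀ * (X * ridgeInv ε X) = 1 - ε • ridgeInv ε X := by
  have h := ridge_mul_ridgeInv hε X
  rw [add_mul, Matrix.smul_mul, one_mul, Matrix.mul_assoc] at h
  exact eq_sub_of_add_eq h

/-- Diagonal of `A = A (XᵀX + ε) A = (XA)ᵀ(XA) + ε AᵀA`. All bounds on `A` and `XA` that are uniform
in `X` come from this. -/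
theorem ridgeInv_diag_eq (hε : 0 < ε) (X : Matrix (Fin p) (Fin n) ℝ) (j : Fin n) :
    ridgeInv ε X j j =
      ∑ i, (X * ridgeInv ε X) i j ^ 2 + ε * ∑ k, ridgeInv ε X k j ^ 2 := by
  have h : (X * ridgeInv ε X)ᵀ * (X * ridgeInv ε X) + ε • ((ridgeInv ε X)ᵀ * ridgeInv ε X)
      = ridgeInv ε X := by
    rw [Matrix.transpose_mul, Matrix.mul_assoc, gram_mul_ridgeInv hε, ridgeInv_transpose,
      mul_sub, mul_one, Matrix.mul_smul, sub_add_cancel]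
  have h' := congrFun (congrFun h j) j
  rw [← h']
  simp only [Matrix.add_apply, Matrix.smul_apply, Matrix.mul_apply (M := (X * ridgeInv ε X)ᵀ), Matrix.mul_apply (M := (ridgeInv ε X)ᵀ), sq, Matrix.transpose_apply, smul_eq_mul]

theorem ridgeInv_diag_nonneg (hε : 0 < ε) (X : Matrix (Fin p) (Fin n) ℝ) (j : Fin n) :
    0 ≤ ridgeInv ε X j j := by
  rw [ridgeInv_diag_eq hε]; positivity

/-- The preceding identity yields `ε a² ≤ a` for a diagonal entry `a`. -/
theorem ridgeInv_diag_le (hε : 0 < ε) (X : Matrix (Fin p) (Fin n) ℝ) (j : Fin n) :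
    ridgeInv ε X j j ≤ ε⁻¹ := by
  have h := ridgeInv_diag_eq hε X j
  have h1 : ridgeInv ε X j j ^ 2 ≤ ∑ k, ridgeInv ε X k j ^ 2 :=
    Finset.single_le_sum (f := fun k => ridgeInv ε X k j ^ 2) (fun _ _ => sq_nonneg _)
      (Finset.mem_univ j)
  have h2 : 0 ≤ ∑ i, (X * ridgeInv ε X) i j ^ 2 := by positivity
  have h3 : ε * ridgeInv ε X j j ^ 2 ≤ ridgeInv ε X j j := by
    nlinarith [mul_le_mul_of_nonneg_left h1 hε.le]
  by_contra hlt
  push Not at hlt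
  have h4 : 1 < ε * ridgeInv ε X j j := by
    rwa [inv_lt_iff_one_lt_mul₀' hε] at hlt
  have h5 : 0 < ridgeInv ε X j j := lt_trans (inv_pos.2 hε) hlt
  nlinarith

theorem mul_ridgeInv_sq_le (hε : 0 < ε) (X : Matrix (Fin p) (Fin n) ℝ) (i : Fin p) (j : Fin n) :
    (X * ridgeInv ε X) i j ^ 2 ≤ ridgeInv ε X j j := by
  have h1 : (X * ridgeInv ε X) i j ^ 2 ≤ ∑ k, (X * ridgeInv ε X) k j ^ 2 :=
    Finset.single_le_sum (f := fun k => (X * ridgeInv ε X) k j ^ 2) (fun _ _ => sq_nonneg _)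
      (Finset.mem_univ i)
  have h2 : 0 ≤ ε * ∑ k, ridgeInv ε X k j ^ 2 := by positivity
  linarith [ridgeInv_diag_eq hε X j]

theorem sum_mul_ridgeInv_sq_le (hε : 0 < ε) (X : Matrix (Fin p) (Fin n) ℝ) :
    ∑ i, ∑ j, (X * ridgeInv ε X) i j ^ 2 ≤ (ridgeInv ε X).trace := by
  rw [Finset.sum_comm]
  refine Finset.sum_le_sum fun j _ => ?_
  have h2 : 0 ≤ ε * ∑ k, ridgeInv ε X k j ^ 2 := by positivity
  simp only [Matrix.diag_apply]
  linarith [ridgeInv_diag_eq hε X j]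

theorem ridgeInv_trace_nonneg (hε : 0 < ε) (X : Matrix (Fin p) (Fin n) ℝ) :
    0 ≤ (ridgeInv ε X).trace :=
  Finset.sum_nonneg fun j _ => ridgeInv_diag_nonneg hε X j

theorem sum_mul_mul_ridgeInv (hε : 0 < ε) (X : Matrix (Fin p) (Fin n) ℝ) :
    ∑ i, ∑ j, X i j * (X * ridgeInv ε X) i j = n - ε * (ridgeInv ε X).trace := by
  have h := congrArg Matrix.trace (gram_mul_ridgeInv hε X)
  rw [Matrix.trace_sub, Matrix.trace_one, Matrix.trace_smul, Fintype.card_fin, smul_eq_mul] at h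
  rw [← h, Finset.sum_comm]
  simp [Matrix.trace, Matrix.mul_apply (M := Xᵀ)]

theorem trace_ridge_proj (hε : 0 < ε) (X : Matrix (Fin p) (Fin n) ℝ) :
    (X * ridgeInv ε X * Xᵀ).trace = n - ε * (ridgeInv ε X).trace := by
  rw [Matrix.trace_mul_comm, gram_mul_ridgeInv hε, Matrix.trace_sub, Matrix.trace_one,
    Matrix.trace_smul, Fintype.card_fin, smul_eq_mul]

theorem ridgeInv_posSemidef (hε : 0 < ε) (X : Matrix (Fin p) (Fin n) ℝ) :
    (ridgeInv ε X).PosSemidef := (posDef_ridge hε X).inv.posSemidef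

theorem ridge_proj_diag_nonneg (hε : 0 < ε) (X : Matrix (Fin p) (Fin n) ℝ) (i : Fin p) :
    0 ≤ (X * ridgeInv ε X * Xᵀ) i i := by
  have h := (ridgeInv_posSemidef hε X).mul_mul_conjTranspose_same X
  rw [Matrix.conjTranspose_eq_transpose_of_trivial] at h
  exact h.diag_nonneg

theorem ridge_proj_diag_le (hε : 0 < ε) (X : Matrix (Fin p) (Fin n) ℝ) (i : Fin p) :
    (X * ridgeInv ε X * Xᵀ) i i ≤ n := by
  have h1 : (X * ridgeInv ε X * Xᵀ) i i ≤ (X * ridgeInv ε X * Xᵀ).trace :=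
    Finset.single_le_sum (f := fun k => (X * ridgeInv ε X * Xᵀ) k k)
      (fun k _ => ridge_proj_diag_nonneg hε X k) (Finset.mem_univ i)
  rw [trace_ridge_proj hε] at h1
  linarith [mul_nonneg hε.le (ridgeInv_trace_nonneg hε X)]

/-- Evaluating the quadratic form at `eᵢ ± eⱼ` gives `2|Aᵢⱼ| ≤ Aᵢᵢ + Aⱼⱼ`. Thus control of the trace
controls every entry. -/
theorem _root_.Matrix.PosSemidef.abs_apply_le_trace {A : Matrix (Fin n) (Fin n) ℝ}
    (hA : A.PosSemidef) (i j : Fin n) : |A i j| ≤ A.trace := by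
  have hd : ∀ k, A k k ≤ A.trace := fun k =>
    Finset.single_le_sum (f := fun k => A k k) (fun k _ => hA.diag_nonneg) (Finset.mem_univ k)
  have hs : A j i = A i j := by simpa using hA.isHermitian.apply i j
  have key : ∀ s : ℝ, 0 ≤ A i i + 2 * s * A i j + s ^ 2 * A j j := fun s => by
    have h := hA.dotProduct_mulVec_nonneg (Pi.single i 1 + s • Pi.single j 1)
    simp only [star_trivial, Matrix.mulVec_add, Matrix.mulVec_smul, dotProduct_add,
      add_dotProduct, smul_dotProduct, dotProduct_smul, single_dotProduct, Matrix.mulVec_single,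
      one_mul, smul_eq_mul, Matrix.col_apply, MulOpposite.op_one, one_smul] at h
    rw [hs] at h
    linarith
  have h1 := key 1
  have h2 := key (-1)
  rw [abs_le]
  constructor <;> linarith [hd i, hd j]

attribute [local instance] Matrix.linftyOpNormedRing Matrix.linftyOpNormedAlgebra

/-- The rule `d(G⁻¹) = -G⁻¹ (dG) G⁻¹` along a path of Gram matrices quadratic in `t`. The local norm
instances only serve to make matrices a normed algebra. -/
theorem hasDerivAt_ridgeInv (hε : 0 < ε) (X E : Matrix (Fin p) (Fin n) ℝ) :
    HasDerivAt (fun t : ℝ => ridgeInv ε (X + t • E))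
      (-(ridgeInv ε X * (Eᵀ * X + Xᵀ * E) * ridgeInv ε X)) 0 := by
  have hG : HasDerivAt (fun t : ℝ => (Xᵀ * X + ε • (1 : Matrix (Fin n) (Fin n) ℝ)) +
      (t • (Eᵀ * X + Xᵀ * E) + t ^ 2 • (Eᵀ * E))) (Eᵀ * X + Xᵀ * E) 0 := by
    have h1 := (hasDerivAt_id (0 : ℝ)).smul_const (Eᵀ * X + Xᵀ * E)
    have h2 := (hasDerivAt_pow 2 (0 : ℝ)).smul_const (Eᵀ * E)
    have h3 := (h1.add h2).const_add (Xᵀ * X + ε • (1 : Matrix (Fin n) (Fin n) ℝ))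
    simp only [one_smul, Nat.cast_ofNat, Nat.add_one_sub_one, pow_one, mul_zero, zero_smul,
      add_zero] at h3
    exact h3
  have hG' : HasDerivAt (fun t : ℝ => (X + t • E)ᵀ * (X + t • E) +
      ε • (1 : Matrix (Fin n) (Fin n) ℝ)) (Eᵀ * X + Xᵀ * E) 0 := by
    refine hG.congr_of_eventuallyEq (Filter.Eventually.of_forall fun t => ?_)
    simp only [Matrix.transpose_add, Matrix.transpose_smul, Matrix.add_mul, Matrix.mul_add, Matrix.smul_mul,
      Matrix.mul_smul, smul_add, smul_smul, sq]
    abel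
  obtain ⟨u, hu⟩ := isUnit_ridge hε X
  have hinv := hasFDerivAt_ringInverse (𝕜 := ℝ) u
  have hu' : (u : Matrix (Fin n) (Fin n) ℝ) = (X + (0 : ℝ) • E)ᵀ * (X + (0 : ℝ) • E) +
      ε • (1 : Matrix (Fin n) (Fin n) ℝ) := by rw [hu]; simp
  rw [hu'] at hinv
  have h := hinv.comp_hasDerivAt (0 : ℝ) hG'
  have hA : ((u⁻¹ : (Matrix (Fin n) (Fin n) ℝ)ˣ) : Matrix (Fin n) (Fin n) ℝ) = ridgeInv ε X := by
    rw [Matrix.coe_units_inv, hu, ridgeInv]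
  rw [hA] at h
  refine (h.congr_of_eventuallyEq (Filter.Eventually.of_forall fun t => ?_)).congr_deriv ?_
  · simp only [Function.comp_apply, ridgeInv, Matrix.nonsing_inv_eq_ringInverse]
  · simp

/-- Product rule: moving the factor `X` gives `Aⱼⱼ`; moving `A` gives the other two terms, one for
each half of `d(XᵀX) = EᵀX + XᵀE`. -/
theorem hasDerivAt_mul_ridgeInv (hε : 0 < ε) (X : Matrix (Fin p) (Fin n) ℝ) (i : Fin p)
    (j : Fin n) :
    HasDerivAt (fun t : ℝ => ((X + t • Matrix.single i j (1 : ℝ)) *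
        ridgeInv ε (X + t • Matrix.single i j (1 : ℝ))) i j)
      (ridgeInv ε X j j - (X * ridgeInv ε X) i j ^ 2 -
        (X * ridgeInv ε X * Xᵀ) i i * ridgeInv ε X j j) 0 := by
  set E : Matrix (Fin p) (Fin n) ℝ := Matrix.single i j (1 : ℝ) with hE
  let L (Y : Matrix (Fin p) (Fin n) ℝ) : Matrix (Fin n) (Fin n) ℝ →ₗ[ℝ] ℝ :=
    { toFun := fun A => (Y * A) i j
      map_add' := fun A B => by simp [Matrix.mul_add]
      map_smul' := fun c A => by simp }
  have hd := hasDerivAt_ridgeInv hε X E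
  have hL : ∀ Y : Matrix (Fin p) (Fin n) ℝ,
      HasDerivAt (fun t : ℝ => (Y * ridgeInv ε (X + t • E)) i j)
        ((Y * -(ridgeInv ε X * (Eᵀ * X + Xᵀ * E) * ridgeInv ε X)) i j) 0 := fun Y =>
    (LinearMap.toContinuousLinearMap (L Y)).hasFDerivAt.comp_hasDerivAt (0 : ℝ) hd
  have h3 := (hL X).add ((hasDerivAt_id (0 : ℝ)).mul (hL E))
  refine (h3.congr_of_eventuallyEq (Filter.Eventually.of_forall fun t => ?_)).congr_deriv ?_
  · simp [Matrix.add_mul]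
  · have e1 : (X * (ridgeInv ε X * (Eᵀ * X + Xᵀ * E) * ridgeInv ε X)) i j =
        (X * ridgeInv ε X) i j ^ 2 + (X * ridgeInv ε X * Xᵀ) i i * ridgeInv ε X j j := by
      have : X * (ridgeInv ε X * (Eᵀ * X + Xᵀ * E) * ridgeInv ε X) =
        (X * ridgeInv ε X) * (Eᵀ * (X * ridgeInv ε X)) +
          (X * ridgeInv ε X * Xᵀ) * (E * ridgeInv ε X) := by
        simp only [Matrix.mul_add, Matrix.add_mul, Matrix.mul_assoc]
      rw [this, Matrix.add_apply, hE, Matrix.transpose_single]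
      rw [Matrix.mul_apply, Matrix.mul_apply (M := X * ridgeInv ε X * Xᵀ)]
      rw [Finset.sum_eq_single j, Finset.sum_eq_single i]
      · simp [sq]
      · intro b _ hb
        simp [Matrix.single_mul_apply_of_ne _ _ _ _ _ hb]
      · simp
      · intro b _ hb
        simp [Matrix.single_mul_apply_of_ne _ _ _ _ _ hb]
      · simp
    have e2 : (E * ridgeInv ε X) i j = ridgeInv ε X j j := by simp [hE]
    rw [Matrix.mul_neg, Matrix.neg_apply, e1, zero_smul, add_zero, e2, id]
    ring

end Ridge

/-! ### Stein's identity for independent standard Gaussians. -/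

section Stein

theorem hasDerivAt_gaussianPDFReal_std (x : ℝ) :
    HasDerivAt (gaussianPDFReal 0 1) (-(x * gaussianPDFReal 0 1 x)) x := by
  have h : HasDerivAt (fun x : ℝ => (√(2 * Real.pi * (1 : ℝ≥0)))⁻¹ *
      Real.exp (-(x - 0) ^ 2 / (2 * (1 : ℝ≥0))))
      (-(x * ((√(2 * Real.pi * (1 : ℝ≥0)))⁻¹ * Real.exp (-(x - 0) ^ 2 / (2 * (1 : ℝ≥0)))))) x := by
    have h1 : HasDerivAt (fun x : ℝ => -(x - 0) ^ 2 / (2 * (1 : ℝ≥0))) (-x) x := by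
      have := ((((hasDerivAt_id x).sub_const 0).pow 2).neg).div_const (2 * ((1 : ℝ≥0) : ℝ))
      refine this.congr_deriv ?_
      simp
      ring
    refine (h1.exp.const_mul _).congr_deriv ?_
    ring
  exact h

theorem integrable_gaussianPDFReal_mul {f : ℝ → ℝ} (hf : Integrable f (gaussianReal 0 1)) :
    Integrable (fun x => gaussianPDFReal 0 1 x * f x) := by
  rw [gaussianReal_of_var_ne_zero 0 one_ne_zero,
    integrable_withDensity_iff_integrable_smul' (measurable_gaussianPDF 0 1)
      (Filter.Eventually.of_forall fun _ => gaussianPDF_lt_top)] at hf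
  simpa [toReal_gaussianPDF] using hf

theorem integrable_id_gaussianReal : Integrable (fun x : ℝ => x) (gaussianReal 0 1) :=
  (memLp_id_gaussianReal 1).integrable le_rfl

/-- Stein's identity for one standard Gaussian variable. -/
theorem integral_id_mul_gaussianReal {f f' : ℝ → ℝ} (hf : ∀ x, HasDerivAt f (f' x) x)
    {C C' : ℝ} (hC : ∀ x, |f x| ≤ C) (hC' : ∀ x, |f' x| ≤ C') :
    ∫ x, x * f x ∂gaussianReal 0 1 = ∫ x, f' x ∂gaussianReal 0 1 := by
  have hfm : Measurable f :=
    (continuous_iff_continuousAt.2 fun x => (hf x).continuousAt).measurable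
  have hf'm : Measurable f' := by
    rw [show f' = deriv f from funext fun x => (hf x).deriv.symm]
    exact measurable_deriv f
  have i0 : Integrable f (gaussianReal 0 1) :=
    Integrable.of_bound hfm.aestronglyMeasurable C (Filter.Eventually.of_forall hC)
  have i1 : Integrable f' (gaussianReal 0 1) :=
    Integrable.of_bound hf'm.aestronglyMeasurable C' (Filter.Eventually.of_forall hC')
  have i2 : Integrable (fun x => f x * x) (gaussianReal 0 1) :=
    integrable_id_gaussianReal.bdd_mul hfm.aestronglyMeasurable
      (Filter.Eventually.of_forall hC)
  have j0 := integrable_gaussianPDFReal_mul i0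
  have j1 := integrable_gaussianPDFReal_mul i1
  have j2 := integrable_gaussianPDFReal_mul i2
  -- Integration by parts against the density `φ`, using `φ' = -xφ`; integrability of the three
  -- products disposes of the boundary terms.
  have key := integral_mul_deriv_eq_deriv_mul_of_integrable (u := f) (u' := f')
    (v := gaussianPDFReal 0 1) (v' := fun x => -(x * gaussianPDFReal 0 1 x))
    (fun x _ => hf x) (fun x _ => hasDerivAt_gaussianPDFReal_std x)
    (by refine j2.neg.congr (Filter.Eventually.of_forall fun x => ?_); simp; ring)
    (by refine j1.congr (Filter.Eventually.of_forall fun x => ?_); simp; ring)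
    (by refine j0.congr (Filter.Eventually.of_forall fun x => ?_); simp; ring)
  rw [integral_gaussianReal_eq_integral_smul one_ne_zero,
    integral_gaussianReal_eq_integral_smul one_ne_zero]
  calc ∫ x, gaussianPDFReal 0 1 x • (x * f x)
      = - ∫ x, f x * -(x * gaussianPDFReal 0 1 x) := by
        rw [← integral_neg]; congr 1; ext x; simp; ring
    _ = ∫ x, gaussianPDFReal 0 1 x • f' x := by
        rw [key, neg_neg]; congr 1; ext x; simp; ring

variable {ι : Type*} [Fintype ι]

/-- Resampling one coordinate independently keeps the product law. It is enough to test boxes, whose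
preimage frees side `k` and constrains the new sample instead. -/
theorem measurePreserving_update [DecidableEq ι] {α : ι → Type*} [∀ i, MeasurableSpace (α i)]
    (μ : ∀ i, Measure (α i)) [∀ i, IsProbabilityMeasure (μ i)] (k : ι) :
    MeasurePreserving (fun q : (∀ i, α i) × α k => Function.update q.1 k q.2)
      ((Measure.pi μ).prod (μ k)) (Measure.pi μ) := by
  have hm : Measurable (fun q : (∀ i, α i) × α k => Function.update q.1 k q.2) :=
    measurable_update'
  refine ⟨hm, (Measure.pi_eq fun s hs => ?_).symm⟩
  rw [Measure.map_apply hm (MeasurableSet.univ_pi hs)]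
  have hpre : (fun q : (∀ i, α i) × α k => Function.update q.1 k q.2) ⁻¹' (Set.univ.pi s) =
      (Set.univ.pi (Function.update s k Set.univ)) ×ˢ s k := by
    ext ⟨x, t⟩
    simp only [Set.mem_preimage, Set.mem_pi, Set.mem_univ, true_implies, Set.mem_prod]
    constructor
    · intro h
      refine ⟨fun i => ?_, by simpa using h k⟩
      by_cases hi : i = k
      · subst hi; simp
      · simpa [hi] using h i
    · rintro ⟨h, ht⟩ i
      by_cases hi : i = k
      · subst hi; simpa using ht
      · simpa [hi] using h i
  rw [hpre, Measure.prod_prod, Measure.pi_pi, ← Finset.mul_prod_erase _ _ (Finset.mem_univ k),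
    ← Finset.mul_prod_erase _ (fun i => μ i (s i)) (Finset.mem_univ k)]
  rw [Function.update_self, measure_univ, one_mul, mul_comm]
  congr 1
  refine Finset.prod_congr rfl fun i hi => ?_
  rw [Function.update_of_ne (Finset.ne_of_mem_erase hi)]

theorem integral_pi_eq_integral_update [DecidableEq ι] {α : ι → Type*} [∀ i, MeasurableSpace (α i)]
    (μ : ∀ i, Measure (α i)) [∀ i, IsProbabilityMeasure (μ i)] (k : ι) {h : (∀ i, α i) → ℝ}
    (hi : Integrable h (Measure.pi μ)) :
    ∫ x, h x ∂Measure.pi μ = ∫ x, ∫ t, h (Function.update x k t) ∂μ k ∂Measure.pi μ := by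
  have hmp := measurePreserving_update μ k
  have h1 : Integrable (fun q : (∀ i, α i) × α k => h (Function.update q.1 k q.2))
      ((Measure.pi μ).prod (μ k)) := hmp.integrable_comp_of_integrable hi
  rw [← integral_prod (fun q : (∀ i, α i) × α k => h (Function.update q.1 k q.2)) h1]
  conv_lhs => rw [← hmp.map_eq]
  exact integral_map hmp.measurable.aemeasurable (by rw [hmp.map_eq]; exact hi.1)

/-- The law of a family of independent standard Gaussian variables. -/
noncomputable abbrev stdGaussianPi (ι : Type*) [Fintype ι] : Measure (ι → ℝ) :=
  Measure.pi fun _ => gaussianReal 0 1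

theorem integrable_eval_stdGaussianPi (k : ι) :
    Integrable (fun x : ι → ℝ => x k) (stdGaussianPi ι) :=
  (measurePreserving_eval (fun _ : ι => gaussianReal 0 1) k).integrable_comp_of_integrable
    integrable_id_gaussianReal

/-- Stein's identity for one of several independent standard Gaussian variables. -/
theorem integral_eval_mul_stdGaussianPi [DecidableEq ι] (k : ι) {f g : (ι → ℝ) → ℝ} (hf : Measurable f)
    (hg : Measurable g)
    (hd : ∀ x : ι → ℝ, HasDerivAt (fun t => f (Function.update x k t)) (g x) (x k))
    {C C' : ℝ} (hC : ∀ x, |f x| ≤ C) (hC' : ∀ x, |g x| ≤ C') :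
    ∫ x, x k * f x ∂stdGaussianPi ι = ∫ x, g x ∂stdGaussianPi ι := by
  have i1 : Integrable (fun x => x k * f x) (stdGaussianPi ι) :=
    (integrable_eval_stdGaussianPi k).mul_bdd hf.aestronglyMeasurable
      (Filter.Eventually.of_forall hC)
  have i2 : Integrable g (stdGaussianPi ι) :=
    Integrable.of_bound hg.aestronglyMeasurable C' (Filter.Eventually.of_forall hC')
  rw [integral_pi_eq_integral_update _ k i1, integral_pi_eq_integral_update _ k i2]
  refine integral_congr_ae (Filter.Eventually.of_forall fun x => ?_)
  simp only [Function.update_self]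
  refine integral_id_mul_gaussianReal (C := C) (C' := C') (fun t => ?_) (fun t => hC _)
    (fun t => hC' _)
  simpa using hd (Function.update x k t)

end Stein

/-- The matrix with the given entries. -/
def toMat {p n : ℕ} (x : Fin p × Fin n → ℝ) : Matrix (Fin p) (Fin n) ℝ :=
  Matrix.of fun i j => x (i, j)

/-! ### Stein bound for the expected trace of the regularized inverse. -/

section Trace

variable {p n : ℕ} {ε : ℝ}

theorem continuous_toMat : Continuous (toMat : (Fin p × Fin n → ℝ) → Matrix (Fin p) (Fin n) ℝ) :=
  continuous_matrix fun i j => continuous_apply (i, j)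

theorem toMat_update (x : Fin p × Fin n → ℝ) (i : Fin p) (j : Fin n) (t : ℝ) :
    toMat (Function.update x (i, j) t) =
      toMat x + (t - x (i, j)) • Matrix.single i j (1 : ℝ) := by
  ext a b
  by_cases h : (a, b) = (i, j)
  · obtain ⟨rfl, rfl⟩ := Prod.mk.inj h
    simp [toMat]
  · have h' : ¬ (i = a ∧ j = b) := fun h' => h (by rw [h'.1, h'.2])
    simp [toMat, Function.update_of_ne h, h']

theorem measurable_ridgeInv (i j : Fin n) :
    Measurable fun x : Fin p × Fin n → ℝ => ridgeInv ε (toMat x) i j := by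
  have hG : Continuous fun x : Fin p × Fin n → ℝ =>
      (toMat x)ᵀ * toMat x + ε • (1 : Matrix (Fin n) (Fin n) ℝ) := by
    have := continuous_toMat (p := p) (n := n)
    fun_prop
  simp only [ridgeInv, Matrix.inv_def, Ring.inverse_eq_inv', Matrix.smul_apply, smul_eq_mul]
  exact hG.matrix_det.measurable.inv.mul (hG.matrix_adjugate.matrix_elem i j).measurable

theorem measurable_toMat_apply (i : Fin p) (j : Fin n) :
    Measurable fun x : Fin p × Fin n → ℝ => toMat x i j := measurable_pi_apply (i, j)

theorem measurable_mul_ridgeInv (i : Fin p) (j : Fin n) :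
    Measurable fun x : Fin p × Fin n → ℝ => (toMat x * ridgeInv ε (toMat x)) i j := by
  simp only [Matrix.mul_apply]
  exact Finset.measurable_fun_sum _ fun k _ =>
    (measurable_toMat_apply i k).mul (measurable_ridgeInv k j)

theorem measurable_ridge_proj (i k : Fin p) :
    Measurable fun x : Fin p × Fin n → ℝ => (toMat x * ridgeInv ε (toMat x) * (toMat x)ᵀ) i k := by
  simp only [Matrix.mul_apply (N := (toMat _)ᵀ)]
  exact Finset.measurable_fun_sum _ fun j _ =>
    (measurable_mul_ridgeInv i j).mul (measurable_toMat_apply k j)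

theorem measurable_trace_ridgeInv :
    Measurable fun x : Fin p × Fin n → ℝ => (ridgeInv ε (toMat x)).trace :=
  Finset.measurable_fun_sum _ fun k _ => measurable_ridgeInv k k

theorem abs_mul_ridgeInv_le (hε : 0 < ε) (X : Matrix (Fin p) (Fin n) ℝ) (i : Fin p)
    (j : Fin n) : |(X * ridgeInv ε X) i j| ≤ √ε⁻¹ :=
  Real.abs_le_sqrt ((mul_ridgeInv_sq_le hε X i j).trans (ridgeInv_diag_le hε X j))

theorem abs_deriv_mul_ridgeInv_le (hε : 0 < ε) (X : Matrix (Fin p) (Fin n) ℝ) (i : Fin p)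
    (j : Fin n) :
    |ridgeInv ε X j j - (X * ridgeInv ε X) i j ^ 2 -
        (X * ridgeInv ε X * Xᵀ) i i * ridgeInv ε X j j| ≤ (1 + n) * ε⁻¹ := by
  have h1 := mul_ridgeInv_sq_le hε X i j
  have h2 := ridgeInv_diag_le hε X j
  have h3 := ridgeInv_diag_nonneg hε X j
  have h4 := ridge_proj_diag_le hε X i
  have h5 := ridge_proj_diag_nonneg hε X i
  have h6 : (X * ridgeInv ε X * Xᵀ) i i * ridgeInv ε X j j ≤ n * ε⁻¹ := by gcongr
  have h7 := mul_nonneg h5 h3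
  have h8 := sq_nonneg ((X * ridgeInv ε X) i j)
  have h9 : (0 : ℝ) ≤ n * ε⁻¹ := by positivity
  rw [abs_le]
  constructor <;> linarith

theorem integral_apply_mul_mul_ridgeInv (hε : 0 < ε) (i : Fin p) (j : Fin n) :
    ∫ x : Fin p × Fin n → ℝ, toMat x i j * (toMat x * ridgeInv ε (toMat x)) i j
        ∂stdGaussianPi (Fin p × Fin n) =
      ∫ x : Fin p × Fin n → ℝ, (ridgeInv ε (toMat x) j j -
        (toMat x * ridgeInv ε (toMat x)) i j ^ 2 -
        (toMat x * ridgeInv ε (toMat x) * (toMat x)ᵀ) i i * ridgeInv ε (toMat x) j j)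
        ∂stdGaussianPi (Fin p × Fin n) := by
  refine integral_eval_mul_stdGaussianPi (i, j) (measurable_mul_ridgeInv i j)
    (((measurable_ridgeInv j j).sub ((measurable_mul_ridgeInv i j).pow_const 2)).sub
      ((measurable_ridge_proj i i).mul (measurable_ridgeInv j j))) (fun x => ?_)
    (fun x => abs_mul_ridgeInv_le hε (toMat x) i j)
    (fun x => abs_deriv_mul_ridgeInv_le hε (toMat x) i j)
  have h := hasDerivAt_mul_ridgeInv hε (toMat x) i j
  -- The derivative is known at increment `0`; the increment is `t - x (i, j)`, so it is moved to `t
  -- = x (i, j)`.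
  rw [← sub_self (x (i, j))] at h
  simpa only [toMat_update] using h.comp_sub_const (x (i, j)) (x (i, j))

theorem integrable_trace_ridgeInv (hε : 0 < ε) :
    Integrable (fun x : Fin p × Fin n → ℝ => (ridgeInv ε (toMat x)).trace)
      (stdGaussianPi (Fin p × Fin n)) := by
  refine Integrable.of_bound measurable_trace_ridgeInv.aestronglyMeasurable (n * ε⁻¹)
    (Filter.Eventually.of_forall fun x => ?_)
  rw [Real.norm_of_nonneg (ridgeInv_trace_nonneg hε _)]
  refine (Finset.sum_le_sum fun j _ => ridgeInv_diag_le hε (toMat x) j).trans ?_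
  simp

/-- Sum Stein's identity over all entries. The left side is `n - ε tr A ≤ n` in the mean. On the
right stands `p tr A - ‖XA‖² - tr(XAXᵀ) tr A`, where `‖XA‖² ≤ tr A` and `tr(XAXᵀ) = n - ε tr A ≤ n`;
this accounts for the factor `p - n - 1`. -/
theorem mul_integral_trace_ridgeInv_le (hε : 0 < ε) :
    ((p : ℝ) - n - 1) * ∫ x : Fin p × Fin n → ℝ, (ridgeInv ε (toMat x)).trace
        ∂stdGaussianPi (Fin p × Fin n) ≤ n := by
  have hI1 : ∀ (i : Fin p) (j : Fin n), Integrable (fun x : Fin p × Fin n → ℝ =>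
      toMat x i j * (toMat x * ridgeInv ε (toMat x)) i j) (stdGaussianPi (Fin p × Fin n)) :=
    fun i j => (integrable_eval_stdGaussianPi (i, j)).mul_bdd
      (measurable_mul_ridgeInv i j).aestronglyMeasurable
      (Filter.Eventually.of_forall fun x => abs_mul_ridgeInv_le hε (toMat x) i j)
  have hI2 : ∀ (i : Fin p) (j : Fin n), Integrable (fun x : Fin p × Fin n → ℝ =>
      ridgeInv ε (toMat x) j j - (toMat x * ridgeInv ε (toMat x)) i j ^ 2 -
        (toMat x * ridgeInv ε (toMat x) * (toMat x)ᵀ) i i * ridgeInv ε (toMat x) j j)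
        (stdGaussianPi (Fin p × Fin n)) := fun i j =>
    Integrable.of_bound (((measurable_ridgeInv j j).sub
      ((measurable_mul_ridgeInv i j).pow_const 2)).sub
      ((measurable_ridge_proj i i).mul (measurable_ridgeInv j j))).aestronglyMeasurable _
      (Filter.Eventually.of_forall fun x => abs_deriv_mul_ridgeInv_le hε (toMat x) i j)
  have e1 : ∫ x : Fin p × Fin n → ℝ, ∑ i, ∑ j,
      toMat x i j * (toMat x * ridgeInv ε (toMat x)) i j ∂stdGaussianPi (Fin p × Fin n) =
      ∫ x : Fin p × Fin n → ℝ, ∑ i, ∑ j, (ridgeInv ε (toMat x) j j -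
        (toMat x * ridgeInv ε (toMat x)) i j ^ 2 -
        (toMat x * ridgeInv ε (toMat x) * (toMat x)ᵀ) i i * ridgeInv ε (toMat x) j j)
        ∂stdGaussianPi (Fin p × Fin n) := by
    rw [integral_finsetSum _ fun i _ => integrable_finsetSum _ fun j _ => hI1 i j,
      integral_finsetSum _ fun i _ => integrable_finsetSum _ fun j _ => hI2 i j]
    refine Finset.sum_congr rfl fun i _ => ?_
    rw [integral_finsetSum _ fun j _ => hI1 i j, integral_finsetSum _ fun j _ => hI2 i j]
    exact Finset.sum_congr rfl fun j _ => integral_apply_mul_mul_ridgeInv hε i j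
  have e2 : ∫ x : Fin p × Fin n → ℝ, ∑ i, ∑ j,
      toMat x i j * (toMat x * ridgeInv ε (toMat x)) i j ∂stdGaussianPi (Fin p × Fin n) ≤ n := by
    have : ∫ _ : Fin p × Fin n → ℝ, (n : ℝ) ∂stdGaussianPi (Fin p × Fin n) = n := by simp
    rw [← this]
    refine integral_mono (integrable_finsetSum _ fun i _ => integrable_finsetSum _ fun j _ =>
      hI1 i j) (integrable_const _) fun x => ?_
    simp only [sum_mul_mul_ridgeInv hε]
    linarith [mul_nonneg hε.le (ridgeInv_trace_nonneg hε (toMat x))]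
  rw [← integral_const_mul]
  refine le_trans ?_ (e1 ▸ e2)
  refine integral_mono ((integrable_trace_ridgeInv hε).const_mul _)
    (integrable_finsetSum _ fun i _ => integrable_finsetSum _ fun j _ => hI2 i j) fun x => ?_
  have s1 := sum_mul_ridgeInv_sq_le hε (toMat x)
  have s2 : ∑ i, ∑ j, (toMat x * ridgeInv ε (toMat x) * (toMat x)ᵀ) i i * ridgeInv ε (toMat x) j j
      = (n - ε * (ridgeInv ε (toMat x)).trace) * (ridgeInv ε (toMat x)).trace := by
    rw [← trace_ridge_proj hε, ← Finset.sum_mul_sum]; rfl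
  have s3 : ∑ _i : Fin p, ∑ j, ridgeInv ε (toMat x) j j = p * (ridgeInv ε (toMat x)).trace := by
    simp [Matrix.trace]
  simp only [Finset.sum_sub_distrib, s2, s3]
  -- The surplus `ε (tr A)²` has the favourable sign and is dropped.
  have := mul_nonneg hε.le (mul_self_nonneg (ridgeInv ε (toMat x)).trace)
  linarith

end Trace

/-! ### Removing the regularization: full rank and the inverse Gram trace. -/

section GramInverse

variable {p n : ℕ}

theorem gram_mul_gramInv {X : Matrix (Fin p) (Fin n) ℝ} (h : IsUnit (Xᵀ * X)) :
    Xᵀ * X * ridgeInv 0 X = 1 := by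
  simpa [ridgeInv] using Matrix.mul_nonsing_inv _ ((Matrix.isUnit_iff_isUnit_det _).1 h)

theorem gramInv_eq_zero {X : Matrix (Fin p) (Fin n) ℝ} (h : ¬ IsUnit (Xᵀ * X)) :
    ridgeInv 0 X = 0 := by
  rw [Matrix.isUnit_iff_isUnit_det] at h
  simpa [ridgeInv] using Matrix.nonsing_inv_apply_not_isUnit _ h

/-- No rank condition is needed, because the inverse of a singular matrix is `0` by convention. The
same therefore holds for the bounds and projection identities derived from it. -/
theorem gramInv_mul_gram_mul_gramInv (X : Matrix (Fin p) (Fin n) ℝ) :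
    ridgeInv 0 X * (Xᵀ * X * ridgeInv 0 X) = ridgeInv 0 X := by
  by_cases h : IsUnit (Xᵀ * X)
  · rw [gram_mul_gramInv h, mul_one]
  · simp [gramInv_eq_zero h]

theorem transpose_mul_gramInv_mul_self (X : Matrix (Fin p) (Fin n) ℝ) :
    (X * ridgeInv 0 X)ᵀ * (X * ridgeInv 0 X) = ridgeInv 0 X := by
  rw [Matrix.transpose_mul, ridgeInv_transpose, Matrix.mul_assoc, ← Matrix.mul_assoc Xᵀ,
    gramInv_mul_gram_mul_gramInv]

theorem gramInv_posSemidef (X : Matrix (Fin p) (Fin n) ℝ) : (ridgeInv 0 X).PosSemidef := by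
  rw [← transpose_mul_gramInv_mul_self, ← Matrix.conjTranspose_eq_transpose_of_trivial]
  exact Matrix.posSemidef_conjTranspose_mul_self _

theorem mul_gramInv_sq_le (X : Matrix (Fin p) (Fin n) ℝ) (i : Fin p) (j : Fin n) :
    (X * ridgeInv 0 X) i j ^ 2 ≤ ridgeInv 0 X j j := by
  have h := congrFun (congrFun (transpose_mul_gramInv_mul_self X) j) j
  rw [Matrix.mul_apply] at h
  simp only [Matrix.transpose_apply, ← sq] at h
  rw [← h]
  exact Finset.single_le_sum (f := fun k => (X * ridgeInv 0 X) k j ^ 2) (fun _ _ => sq_nonneg _)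
    (Finset.mem_univ i)

/-- By Cramer's rule the entries are quotients of polynomials in `ε`, with denominator nonzero at
`0`. -/
theorem tendsto_ridgeInv {X : Matrix (Fin p) (Fin n) ℝ} (h : IsUnit (Xᵀ * X)) :
    Filter.Tendsto (fun ε => (ridgeInv ε X).trace) (nhds 0) (nhds (ridgeInv 0 X).trace) := by
  have hG : Continuous fun ε : ℝ => Xᵀ * X + ε • (1 : Matrix (Fin n) (Fin n) ℝ) := by fun_prop
  refine tendsto_finsetSum _ fun j _ => ?_
  simp only [ridgeInv, Matrix.inv_def, Ring.inverse_eq_inv', Matrix.diag_apply,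
    Matrix.smul_apply, smul_eq_mul]
  have h1 : ContinuousAt (fun ε : ℝ => (Xᵀ * X + ε • (1 : Matrix (Fin n) (Fin n) ℝ)).det) 0 :=
    hG.matrix_det.continuousAt
  have h2 : ContinuousAt
      (fun ε : ℝ => (Xᵀ * X + ε • (1 : Matrix (Fin n) (Fin n) ℝ)).adjugate j j) 0 :=
    (hG.matrix_adjugate.matrix_elem j j).continuousAt
  refine ((h1.inv₀ ?_).mul h2)
  simpa using ((Matrix.isUnit_iff_isUnit_det _).1 h).ne_zero

/-- A kernel vector `v` of the Gram matrix satisfies `ε A v = v`. Entries of `A` are at most its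
trace, so a coordinate `vᵢ ≠ 0` gives `|vᵢ| ≤ ε tr A ∑ⱼ |vⱼ|`. -/
theorem exists_div_le_trace_ridgeInv {X : Matrix (Fin p) (Fin n) ℝ} (h : ¬ IsUnit (Xᵀ * X)) :
    ∃ c : ℝ, 0 < c ∧ ∀ ε > 0, c * ε⁻¹ ≤ (ridgeInv ε X).trace := by
  rw [Matrix.isUnit_iff_isUnit_det, isUnit_iff_ne_zero, not_not,
    ← Matrix.exists_mulVec_eq_zero_iff] at h
  obtain ⟨v, hv, hGv⟩ := h
  obtain ⟨i, hi⟩ := Function.ne_iff.1 hv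
  have hi' : 0 < |v i| := abs_pos.2 hi
  have hs : |v i| ≤ ∑ j, |v j| :=
    Finset.single_le_sum (f := fun j => |v j|) (fun _ _ => abs_nonneg _) (Finset.mem_univ i)
  have hs' : 0 < ∑ j, |v j| := hi'.trans_le hs
  refine ⟨|v i| / ∑ j, |v j|, by positivity, fun ε hε => ?_⟩
  have h1 : ridgeInv ε X *ᵥ ((Xᵀ * X + ε • (1 : Matrix (Fin n) (Fin n) ℝ)) *ᵥ v) = v := by
    rw [Matrix.mulVec_mulVec, ridgeInv,
      Matrix.nonsing_inv_mul _ ((Matrix.isUnit_iff_isUnit_det _).1 (isUnit_ridge hε X)),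
      Matrix.one_mulVec]
  rw [Matrix.add_mulVec, hGv, zero_add, Matrix.smul_mulVec, Matrix.one_mulVec,
    Matrix.mulVec_smul] at h1
  have h2 : |v i| ≤ ε * ((ridgeInv ε X).trace * ∑ j, |v j|) := by
    calc |v i| = |ε * ∑ j, ridgeInv ε X i j * v j| := by
          rw [← congrFun h1 i]; simp [Matrix.mulVec, dotProduct]
      _ = ε * |∑ j, ridgeInv ε X i j * v j| := by rw [abs_mul, abs_of_pos hε]
      _ ≤ ε * ∑ j, |ridgeInv ε X i j * v j| := by
          exact mul_le_mul_of_nonneg_left (Finset.abs_sum_le_sum_abs _ _) hε.le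
      _ ≤ ε * ((ridgeInv ε X).trace * ∑ j, |v j|) := by
          refine mul_le_mul_of_nonneg_left ?_ hε.le
          rw [Finset.mul_sum]
          refine Finset.sum_le_sum fun j _ => ?_
          rw [abs_mul]
          exact mul_le_mul_of_nonneg_right
            ((ridgeInv_posSemidef hε X).abs_apply_le_trace i j) (abs_nonneg _)
  rw [← div_eq_mul_inv, div_div, div_le_iff₀ (by positivity)]
  linarith

theorem lintegral_liminf_trace_ridgeInv_le (hpn : n + 2 ≤ p) :
    ∫⁻ x : Fin p × Fin n → ℝ, Filter.liminf (fun k : ℕ =>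
        ENNReal.ofReal (ridgeInv (1 / ((k : ℝ) + 1)) (toMat x)).trace) Filter.atTop
        ∂stdGaussianPi (Fin p × Fin n) ≤ ENNReal.ofReal (n / ((p : ℝ) - n - 1)) := by
  refine (lintegral_liminf_le fun k => measurable_trace_ridgeInv.ennreal_ofReal).trans ?_
  -- After Fatou, an eventual lower bound of the expectations lies below one of them, and each obeys
  -- the Stein bound.
  refine Filter.liminf_le_of_le (by isBoundedDefault) fun b hb => ?_
  obtain ⟨k, hk⟩ := hb.exists
  have hε : (0 : ℝ) < 1 / ((k : ℝ) + 1) := by positivity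
  refine hk.trans ?_
  rw [← ofReal_integral_eq_lintegral_ofReal (integrable_trace_ridgeInv hε)
    (Filter.Eventually.of_forall fun x => ridgeInv_trace_nonneg hε (toMat x))]
  refine ENNReal.ofReal_le_ofReal ?_
  have hp : (n : ℝ) + 2 ≤ p := by exact_mod_cast hpn
  rw [le_div_iff₀ (by linarith), mul_comm]
  exact mul_integral_trace_ridgeInv_le hε

theorem liminf_trace_ridgeInv_of_isUnit {X : Matrix (Fin p) (Fin n) ℝ} (h : IsUnit (Xᵀ * X)) :
    Filter.liminf (fun k : ℕ => ENNReal.ofReal (ridgeInv (1 / ((k : ℝ) + 1)) X).trace)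
      Filter.atTop = ENNReal.ofReal (ridgeInv 0 X).trace :=
  (((ENNReal.continuous_ofReal.tendsto _).comp
    ((tendsto_ridgeInv h).comp tendsto_one_div_add_atTop_nhds_zero_nat))).liminf_eq

theorem liminf_trace_ridgeInv_of_not_isUnit {X : Matrix (Fin p) (Fin n) ℝ}
    (h : ¬ IsUnit (Xᵀ * X)) :
    Filter.liminf (fun k : ℕ => ENNReal.ofReal (ridgeInv (1 / ((k : ℝ) + 1)) X).trace)
      Filter.atTop = ⊤ := by
  obtain ⟨c, hc, hle⟩ := exists_div_le_trace_ridgeInv h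
  have ht : Filter.Tendsto (fun k : ℕ => (ridgeInv (1 / ((k : ℝ) + 1)) X).trace)
      Filter.atTop Filter.atTop := by
    refine Filter.tendsto_atTop_mono (fun k => hle _ (by positivity)) ?_
    simp only [one_div, inv_inv]
    exact (tendsto_natCast_atTop_atTop.atTop_add tendsto_const_nhds).const_mul_atTop hc
  exact (ENNReal.tendsto_ofReal_atTop.comp ht).liminf_eq

/-- A standard Gaussian matrix almost surely has full column rank. -/
theorem ae_isUnit_gram (hpn : n + 2 ≤ p) :
    ∀ᵐ x : Fin p × Fin n → ℝ ∂stdGaussianPi (Fin p × Fin n), IsUnit ((toMat x)ᵀ * toMat x) := by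
  -- The liminf has finite integral, hence is finite almost everywhere, but it is `⊤` at every
  -- rank-deficient matrix.
  have h := ae_lt_top (Measurable.liminf fun k => measurable_trace_ridgeInv.ennreal_ofReal)
    (ne_top_of_le_ne_top ENNReal.ofReal_ne_top (lintegral_liminf_trace_ridgeInv_le (n := n) hpn))
  filter_upwards [h] with x hx
  by_contra hu
  exact hx.ne (liminf_trace_ridgeInv_of_not_isUnit hu)

theorem lintegral_trace_gramInv_le (hpn : n + 2 ≤ p) :
    ∫⁻ x : Fin p × Fin n → ℝ, ENNReal.ofReal (ridgeInv 0 (toMat x)).trace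
      ∂stdGaussianPi (Fin p × Fin n) ≤ ENNReal.ofReal (n / ((p : ℝ) - n - 1)) := by
  refine le_trans (le_of_eq (lintegral_congr_ae ?_)) (lintegral_liminf_trace_ridgeInv_le hpn)
  filter_upwards [ae_isUnit_gram hpn] with x hx
  exact (liminf_trace_ridgeInv_of_isUnit hx).symm

theorem integrable_trace_gramInv (hpn : n + 2 ≤ p) :
    Integrable (fun x : Fin p × Fin n → ℝ => (ridgeInv 0 (toMat x)).trace)
      (stdGaussianPi (Fin p × Fin n)) := by
  refine ⟨measurable_trace_ridgeInv.aestronglyMeasurable, ?_⟩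
  rw [hasFiniteIntegral_iff_ofReal
    (Filter.Eventually.of_forall fun x => (gramInv_posSemidef (toMat x)).trace_nonneg)]
  exact (lintegral_trace_gramInv_le hpn).trans_lt ENNReal.ofReal_lt_top

theorem integral_trace_gramInv_le (hpn : n + 2 ≤ p) :
    ∫ x : Fin p × Fin n → ℝ, (ridgeInv 0 (toMat x)).trace ∂stdGaussianPi (Fin p × Fin n) ≤
      n / ((p : ℝ) - n - 1) := by
  have hp : (n : ℝ) + 2 ≤ p := by exact_mod_cast hpn
  rw [integral_eq_lintegral_of_nonneg_ae
    (Filter.Eventually.of_forall fun x => (gramInv_posSemidef (toMat x)).trace_nonneg)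
    measurable_trace_ridgeInv.aestronglyMeasurable]
  exact ENNReal.toReal_le_of_le_ofReal (div_nonneg (by positivity) (by linarith))
    (lintegral_trace_gramInv_le hpn)

theorem integrable_gramInv_apply (hpn : n + 2 ≤ p) (i j : Fin n) :
    Integrable (fun x : Fin p × Fin n → ℝ => ridgeInv 0 (toMat x) i j)
      (stdGaussianPi (Fin p × Fin n)) :=
  (integrable_trace_gramInv hpn).mono' (measurable_ridgeInv i j).aestronglyMeasurable
    (Filter.Eventually.of_forall fun x => (gramInv_posSemidef (toMat x)).abs_apply_le_trace i j)

theorem integrable_mul_gramInv_apply (hpn : n + 2 ≤ p) (i : Fin p) (j : Fin n) :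
    Integrable (fun x : Fin p × Fin n → ℝ => (toMat x * ridgeInv 0 (toMat x)) i j)
      (stdGaussianPi (Fin p × Fin n)) := by
  refine ((integrable_const (1 : ℝ)).add (integrable_gramInv_apply hpn j j)).mono'
    (measurable_mul_ridgeInv i j).aestronglyMeasurable (Filter.Eventually.of_forall fun x => ?_)
  have h := mul_gramInv_sq_le (toMat x) i j
  rw [Real.norm_eq_abs, Pi.add_apply]
  -- Domination by `|t| ≤ 1 + t²`, with `t²` bounded by a diagonal entry of the inverse Gram matrix.
  nlinarith [sq_abs ((toMat x * ridgeInv 0 (toMat x)) i j),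
    sq_nonneg (|(toMat x * ridgeInv 0 (toMat x)) i j| - 1)]

end GramInverse

/-! ### Mean of the random projection onto the column space. -/

section Projection

variable {p n : ℕ}

/-- The orthogonal projection onto the column space of a matrix of full column rank. -/
noncomputable def colProj (X : Matrix (Fin p) (Fin n) ℝ) : Matrix (Fin p) (Fin p) ℝ :=
  X * ridgeInv 0 X * Xᵀ

theorem colProj_transpose (X : Matrix (Fin p) (Fin n) ℝ) : (colProj X)ᵀ = colProj X := by
  simp [colProj, Matrix.transpose_mul, ridgeInv_transpose, Matrix.mul_assoc]

theorem colProj_mul_self (X : Matrix (Fin p) (Fin n) ℝ) : colProj X * colProj X = colProj X := by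
  have h := gramInv_mul_gram_mul_gramInv X
  calc colProj X * colProj X = X * (ridgeInv 0 X * (Xᵀ * X * ridgeInv 0 X)) * Xᵀ := by
        simp only [colProj, Matrix.mul_assoc]
    _ = colProj X := by rw [h, colProj]

theorem colProj_trace {X : Matrix (Fin p) (Fin n) ℝ} (h : IsUnit (Xᵀ * X)) :
    (colProj X).trace = n := by
  rw [colProj, Matrix.trace_mul_comm, ← Matrix.mul_assoc, gram_mul_gramInv h, Matrix.trace_one,
    Fintype.card_fin]

/-- For a symmetric idempotent, `Πᵢᵢ = ∑ₖ Πᵢₖ²`; so `Πᵢᵢ² ≤ Πᵢᵢ ≤ 1` and every `Πᵢₖ² ≤ Πᵢᵢ`. -/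
theorem abs_colProj_apply_le (X : Matrix (Fin p) (Fin n) ℝ) (i j : Fin p) :
    |colProj X i j| ≤ 1 := by
  have h : ∀ i, colProj X i i = ∑ k, colProj X i k ^ 2 := fun i => by
    have h := congrFun (congrFun (colProj_mul_self X) i) i
    rw [← h, Matrix.mul_apply]
    refine Finset.sum_congr rfl fun k _ => ?_
    rw [sq, ← congrFun (congrFun (colProj_transpose X) i) k, Matrix.transpose_apply,
      ← congrFun (congrFun (colProj_transpose X) k) i, Matrix.transpose_apply]
  have h1 : ∀ k, colProj X i k ^ 2 ≤ colProj X i i := fun k => by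
    rw [h i]
    exact Finset.single_le_sum (f := fun k => colProj X i k ^ 2) (fun _ _ => sq_nonneg _)
      (Finset.mem_univ k)
  have h2 := h1 i
  have h3 : colProj X i i ≤ 1 := by nlinarith
  exact abs_le_of_sq_le_sq (by linarith [h1 j]) zero_le_one

theorem measurable_colProj_apply (i j : Fin p) :
    Measurable fun x : Fin p × Fin n → ℝ => colProj (toMat x) i j :=
  measurable_ridge_proj i j

theorem integrable_colProj_apply (i j : Fin p) :
    Integrable (fun x : Fin p × Fin n → ℝ => colProj (toMat x) i j)
      (stdGaussianPi (Fin p × Fin n)) :=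
  Integrable.of_bound (measurable_colProj_apply i j).aestronglyMeasurable 1
    (Filter.Eventually.of_forall fun x => abs_colProj_apply_le (toMat x) i j)

theorem colProj_orthogonal_mul {D : Matrix (Fin p) (Fin p) ℝ} (hD : Dᵀ * D = 1)
    (X : Matrix (Fin p) (Fin n) ℝ) : colProj (D * X) = D * colProj X * Dᵀ := by
  have h : ridgeInv 0 (D * X) = ridgeInv 0 X := by
    rw [ridgeInv, Matrix.transpose_mul, Matrix.mul_assoc, ← Matrix.mul_assoc Dᵀ, hD,
      Matrix.one_mul, ridgeInv]
  simp only [colProj, h, Matrix.transpose_mul, Matrix.mul_assoc]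

theorem colProj_submatrix (e : Equiv.Perm (Fin p)) (X : Matrix (Fin p) (Fin n) ℝ) :
    colProj (X.submatrix e id) = (colProj X).submatrix e e := by
  have h : ridgeInv 0 (X.submatrix e id) = ridgeInv 0 X := by
    rw [ridgeInv, Matrix.transpose_submatrix, Matrix.submatrix_mul_equiv, Matrix.submatrix_id_id,
      ridgeInv]
  ext i j
  simp [colProj, h, Matrix.mul_apply]

/-- Changing the signs of the entries in one row. -/
def negRow (i : Fin p) (x : Fin p × Fin n → ℝ) : Fin p × Fin n → ℝ :=
  fun k => if k.1 = i then -x k else x k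

theorem measurePreserving_negRow (i : Fin p) :
    MeasurePreserving (negRow (n := n) i) (stdGaussianPi (Fin p × Fin n))
      (stdGaussianPi (Fin p × Fin n)) := by
  refine measurePreserving_pi (fun _ => gaussianReal 0 1) (fun _ => gaussianReal 0 1)
    (f := fun (k : Fin p × Fin n) t => if k.1 = i then -t else t) fun k => ?_
  by_cases hk : k.1 = i
  · simp only [hk, if_true]
    exact ⟨measurable_neg, by rw [gaussianReal_map_neg, neg_zero]⟩
  · simp only [hk, if_false]
    exact MeasurePreserving.id _

/-- The sign change is left multiplication by an orthogonal diagonal matrix, which conjugates the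
projection. As it preserves the Gaussian law, off-diagonal means must vanish. -/
theorem colProj_negRow_apply (i j : Fin p) (hij : i ≠ j) (x : Fin p × Fin n → ℝ) :
    colProj (toMat (negRow i x)) i j = -colProj (toMat x) i j := by
  set s : Fin p → ℝ := fun k => if k = i then -1 else 1 with hs
  have h1 : toMat (negRow i x) = Matrix.diagonal s * toMat x := by
    ext a b
    rw [Matrix.diagonal_mul]
    by_cases ha : a = i <;> simp [toMat, negRow, hs, ha]
  have h2 : (Matrix.diagonal s)ᵀ * Matrix.diagonal s = 1 := by
    rw [Matrix.diagonal_transpose, Matrix.diagonal_mul_diagonal, ← Matrix.diagonal_one]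
    congr 1
    ext k
    by_cases hk : k = i <;> simp [hs, hk]
  rw [h1, colProj_orthogonal_mul h2, Matrix.diagonal_transpose, Matrix.mul_diagonal,
    Matrix.diagonal_mul]
  simp [hs, hij.symm]

theorem integral_colProj_apply_ne (i j : Fin p) (hij : i ≠ j) :
    ∫ x : Fin p × Fin n → ℝ, colProj (toMat x) i j ∂stdGaussianPi (Fin p × Fin n) = 0 := by
  have hmp := measurePreserving_negRow (n := n) i
  have h : ∫ x : Fin p × Fin n → ℝ, colProj (toMat (negRow i x)) i j
      ∂stdGaussianPi (Fin p × Fin n) =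
      ∫ x : Fin p × Fin n → ℝ, colProj (toMat x) i j ∂stdGaussianPi (Fin p × Fin n) := by
    conv_rhs => rw [← hmp.map_eq]
    exact (integral_map hmp.measurable.aemeasurable
      (measurable_colProj_apply i j).aestronglyMeasurable).symm
  simp only [colProj_negRow_apply i j hij, integral_neg] at h
  linarith

/-- Swapping rows `i` and `j` preserves the law and exchanges the two diagonal entries. -/
theorem integral_colProj_apply_self_eq (i j : Fin p) :
    ∫ x : Fin p × Fin n → ℝ, colProj (toMat x) i i ∂stdGaussianPi (Fin p × Fin n) =
      ∫ x : Fin p × Fin n → ℝ, colProj (toMat x) j j ∂stdGaussianPi (Fin p × Fin n) := by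
  let e : Fin p × Fin n ≃ Fin p × Fin n := (Equiv.swap i j).prodCongr (Equiv.refl (Fin n))
  have hmp := measurePreserving_piCongrLeft (fun _ : Fin p × Fin n => gaussianReal 0 1) e
  have hmat : ∀ x : Fin p × Fin n → ℝ,
      toMat (MeasurableEquiv.piCongrLeft (fun _ => ℝ) e x) =
        (toMat x).submatrix (Equiv.swap i j) id := fun x => by
    ext a b
    have h := Equiv.piCongrLeft_apply_apply (fun _ : Fin p × Fin n => ℝ) e x
      (Equiv.swap i j a, b)
    have he : e (Equiv.swap i j a, b) = (a, b) := by simp [e]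
    rw [he] at h
    exact h
  have h : ∫ x : Fin p × Fin n → ℝ,
      colProj (toMat (MeasurableEquiv.piCongrLeft (fun _ => ℝ) e x)) j j
      ∂stdGaussianPi (Fin p × Fin n) =
      ∫ x : Fin p × Fin n → ℝ, colProj (toMat x) j j ∂stdGaussianPi (Fin p × Fin n) :=
    hmp.integral_comp' (fun x => colProj (toMat x) j j)
  rw [← h]
  simp [hmat, colProj_submatrix]

theorem integral_colProj_apply (hpn : n + 2 ≤ p) (i j : Fin p) :
    ∫ x : Fin p × Fin n → ℝ, colProj (toMat x) i j ∂stdGaussianPi (Fin p × Fin n) =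
      if i = j then (n : ℝ) / p else 0 := by
  split_ifs with hij
  · subst hij
    have hp : (p : ℝ) ≠ 0 := by
      have : 0 < p := by omega
      positivity
    have h1 : ∫ x : Fin p × Fin n → ℝ, (colProj (toMat x)).trace
        ∂stdGaussianPi (Fin p × Fin n) = n := by
      rw [integral_congr_ae (g := fun _ => (n : ℝ))]
      · simp
      · filter_upwards [ae_isUnit_gram hpn] with x hx using colProj_trace hx
    simp only [Matrix.trace, Matrix.diag_apply] at h1
    rw [integral_finsetSum _ fun k _ => integrable_colProj_apply k k,
      Finset.sum_congr rfl fun k _ => integral_colProj_apply_self_eq k i] at h1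
    rw [eq_div_iff hp, mul_comm]
    simpa using h1
  · exact integral_colProj_apply_ne i j hij

end Projection

/-! ### Closed form of a training step and of the forgetting. -/

section Training

variable {p n : ℕ}

/-- The displacement lies in the column space of `X`, hence is orthogonal to differences of feasible
points, which lie in `ker Xᵀ`. Pythagoras gives minimality, and uniqueness identifies the chosen
solution. -/
theorem trainStep_eq {X : Matrix (Fin p) (Fin n) ℝ} (hX : IsUnit (Xᵀ * X)) (y : Fin n → ℝ)
    (u : EuclideanSpace ℝ (Fin p)) :
    trainStep X y u = u + WithLp.toLp 2 ((X * ridgeInv 0 X) *ᵥ (y - Xᵀ *ᵥ u.ofLp)) := by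
  set r := y - Xᵀ *ᵥ u.ofLp with hr
  set v : EuclideanSpace ℝ (Fin p) := u + WithLp.toLp 2 ((X * ridgeInv 0 X) *ᵥ r) with hv
  have hfit : Xᵀ *ᵥ v.ofLp = y := by
    rw [hv, WithLp.ofLp_add, Matrix.mulVec_add, Matrix.mulVec_mulVec, ← Matrix.mul_assoc,
      gram_mul_gramInv hX, Matrix.one_mulVec, hr]
    abel
  have hsol : IsMinChangeSolution X y u v := by
    refine ⟨hfit, fun w hw => ?_⟩
    have horth : inner ℝ (v - u) (w - v) = 0 := by
      rw [hv, add_sub_cancel_left, ← hv, EuclideanSpace.inner_eq_star_dotProduct, star_trivial,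
        WithLp.ofLp_sub, ← Matrix.mulVec_mulVec, Matrix.dotProduct_mulVec,
        ← Matrix.mulVec_transpose, Matrix.mulVec_sub, hw, hfit, sub_self, zero_dotProduct]
    have hsq : ‖w - u‖ * ‖w - u‖ = ‖v - u‖ * ‖v - u‖ + ‖w - v‖ * ‖w - v‖ := by
      rw [← norm_add_sq_eq_norm_sq_add_norm_sq_of_inner_eq_zero _ _ horth,
        show v - u + (w - v) = w - u by abel]
    exact abs_le_of_sq_le_sq' (by nlinarith [mul_self_nonneg ‖w - v‖]) (norm_nonneg _) |>.2
  have h : ∃ v, IsMinChangeSolution X y u v := ⟨v, hsol⟩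
  rw [trainStep, dif_pos h]
  exact h.choose_spec.unique hsol

theorem colProj_mulVec_dotProduct (X : Matrix (Fin p) (Fin n) ℝ) (x y : Fin p → ℝ) :
    (colProj X *ᵥ x) ⬝ᵥ y = x ⬝ᵥ colProj X *ᵥ y := by
  rw [Matrix.dotProduct_mulVec, ← Matrix.mulVec_transpose, colProj_transpose]

theorem colProj_mul_mul_gramInv (X : Matrix (Fin p) (Fin n) ℝ) :
    colProj X * (X * ridgeInv 0 X) = X * ridgeInv 0 X := by
  rw [colProj, Matrix.mul_assoc, ← Matrix.mul_assoc Xᵀ, Matrix.mul_assoc X,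
    gramInv_mul_gram_mul_gramInv]

theorem mul_gramInv_mulVec_dotProduct_self (X : Matrix (Fin p) (Fin n) ℝ) (z : Fin n → ℝ) :
    ((X * ridgeInv 0 X) *ᵥ z) ⬝ᵥ ((X * ridgeInv 0 X) *ᵥ z) = z ⬝ᵥ ridgeInv 0 X *ᵥ z := by
  rw [Matrix.dotProduct_mulVec, ← Matrix.mulVec_transpose, Matrix.mulVec_mulVec,
    transpose_mul_gramInv_mul_self, dotProduct_comm]

/-- The error after a training step that starts from the error `e`, moves the task by `d` and has
the noise `z`. -/
noncomputable def stepError (X : Matrix (Fin p) (Fin n) ℝ) (e d : Fin p → ℝ) (z : Fin n → ℝ) :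
    Fin p → ℝ :=
  e - colProj X *ᵥ e + colProj X *ᵥ d + (X * ridgeInv 0 X) *ᵥ z

theorem stepError_dotProduct_self (X : Matrix (Fin p) (Fin n) ℝ) (e d : Fin p → ℝ)
    (z : Fin n → ℝ) :
    stepError X e d z ⬝ᵥ stepError X e d z = e ⬝ᵥ e - e ⬝ᵥ colProj X *ᵥ e +
      d ⬝ᵥ colProj X *ᵥ d + 2 * (d ⬝ᵥ (X * ridgeInv 0 X) *ᵥ z) + z ⬝ᵥ ridgeInv 0 X *ᵥ z := by
  have h1 : ∀ x y, (colProj X *ᵥ x) ⬝ᵥ (colProj X *ᵥ y) = x ⬝ᵥ colProj X *ᵥ y := fun x y => by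
    rw [colProj_mulVec_dotProduct, Matrix.mulVec_mulVec, colProj_mul_self]
  have h2 : ∀ x, (colProj X *ᵥ x) ⬝ᵥ ((X * ridgeInv 0 X) *ᵥ z) = x ⬝ᵥ (X * ridgeInv 0 X) *ᵥ z :=
    fun x => by rw [colProj_mulVec_dotProduct, Matrix.mulVec_mulVec, colProj_mul_mul_gramInv]
  have h3 := mul_gramInv_mulVec_dotProduct_self X z
  simp only [stepError, add_dotProduct, sub_dotProduct, dotProduct_add, dotProduct_sub, h1, h2,
    h3, dotProduct_comm ((X * ridgeInv 0 X) *ᵥ z), colProj_mulVec_dotProduct]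
  ring

theorem modelError_eq_dotProduct (u v : EuclideanSpace ℝ (Fin p)) :
    modelError u v = (v.ofLp - u.ofLp) ⬝ᵥ (v.ofLp - u.ofLp) := by
  rw [modelError, ← real_inner_self_eq_norm_sq, EuclideanSpace.inner_eq_star_dotProduct,
    star_trivial, WithLp.ofLp_sub]

/-- The reference point `a` is free because task 2 is also judged against the truth of task 1: `a =
w₁*` gives shift `0` in round 1 and `w₂* - w₁*` in round 2. -/
theorem trainStep_output_sub {X : Matrix (Fin p) (Fin n) ℝ} (hX : IsUnit (Xᵀ * X))
    (wstar u : EuclideanSpace ℝ (Fin p)) (z : Fin n → ℝ) (a : Fin p → ℝ) :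
    (trainStep X (output X wstar z) u).ofLp - a =
      stepError X (u.ofLp - a) (wstar.ofLp - a) z := by
  rw [trainStep_eq hX, output, WithLp.ofLp_add, stepError]
  simp only [Matrix.mulVec_add, Matrix.mulVec_sub, Matrix.mulVec_mulVec, colProj]
  abel

theorem forgetting_two_eq (wstar : ℕ → EuclideanSpace ℝ (Fin p))
    {X : ℕ → Matrix (Fin p) (Fin n) ℝ} (z : ℕ → Fin n → ℝ) (h1 : IsUnit ((X 1)ᵀ * X 1))
    (h2 : IsUnit ((X 2)ᵀ * X 2)) {e d : Fin p → ℝ}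
    (he : e = stepError (X 1) (-(wstar 1).ofLp) 0 (z 1))
    (hd : d = (wstar 2).ofLp - (wstar 1).ofLp) :
    forgetting wstar X z 2 = d ⬝ᵥ colProj (X 2) *ᵥ d - e ⬝ᵥ colProj (X 2) *ᵥ e +
      2 * (d ⬝ᵥ (X 2 * ridgeInv 0 (X 2)) *ᵥ z 2) + z 2 ⬝ᵥ ridgeInv 0 (X 2) *ᵥ z 2 := by
  have m1 : (model wstar X z 1).ofLp - (wstar 1).ofLp = e := by
    rw [model, trainStep_output_sub h1, he, model]
    simp
  have m2 : (model wstar X z 2).ofLp - (wstar 1).ofLp = stepError (X 2) e d (z 2) := by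
    rw [model, trainStep_output_sub h2, m1, hd]
  rw [forgetting]
  norm_num
  rw [modelError_eq_dotProduct, modelError_eq_dotProduct, m1, m2, stepError_dotProduct_self]
  ring

end Training

/-! ### Expectations of the quadratic and cross terms. -/

section Expectation

variable {Ω : Type*} [MeasurableSpace Ω] {P : Measure Ω} {p n : ℕ}

theorem _root_.ProbabilityTheory.iIndepFun.indepFun_family [IsProbabilityMeasure P] {ι α β 𝓧 : Type*} [MeasurableSpace 𝓧]
    [Fintype α] [Fintype β] {f : ι → Ω → 𝓧} (h : iIndepFun f P) (hf : ∀ i, AEMeasurable (f i) P)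
    (a : α → ι) (b : β → ι) (hab : ∀ i j, a i ≠ b j) :
    IndepFun (fun ω i => f (a i) ω) (fun ω j => f (b j) ω) P := by
  classical
  have hd : Disjoint (Finset.univ.image a) (Finset.univ.image b) := by
    rw [Finset.disjoint_left]
    intro k hk hk'
    obtain ⟨i, -, rfl⟩ := Finset.mem_image.1 hk
    obtain ⟨j, -, hj⟩ := Finset.mem_image.1 hk'
    exact hab i j hj.symm
  have hi := h.indepFun_finset₀ _ _ hd hf
  exact hi.comp
    (φ := fun (x : ↥(Finset.univ.image a) → 𝓧) i =>
      x ⟨a i, Finset.mem_image_of_mem a (Finset.mem_univ i)⟩)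
    (ψ := fun (x : ↥(Finset.univ.image b) → 𝓧) j =>
      x ⟨b j, Finset.mem_image_of_mem b (Finset.mem_univ j)⟩)
    (measurable_pi_lambda _ fun _ => measurable_pi_apply _)
    (measurable_pi_lambda _ fun _ => measurable_pi_apply _)

theorem dotProduct_mulVec_eq_sum {ι : Type*} [Fintype ι] (M : Matrix ι ι ℝ) (y : ι → ℝ) :
    y ⬝ᵥ M *ᵥ y = ∑ i, ∑ j, y i * y j * M i j := by
  simp only [dotProduct, Matrix.mulVec, Finset.mul_sum]
  refine Finset.sum_congr rfl fun i _ => Finset.sum_congr rfl fun j _ => ?_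
  ring

/-- The expectation of a random quadratic form at an independent random vector. -/
theorem integrable_integral_quadratic {ι : Type*} [Fintype ι] {M : Ω → Matrix ι ι ℝ}
    {Y : Ω → ι → ℝ}
    (hind : ∀ i j, IndepFun (fun ω => Y ω i * Y ω j) (fun ω => M ω i j) P)
    (hY : ∀ i j, Integrable (fun ω => Y ω i * Y ω j) P)
    (hM : ∀ i j, Integrable (fun ω => M ω i j) P) :
    Integrable (fun ω => Y ω ⬝ᵥ M ω *ᵥ Y ω) P ∧
      ∫ ω, Y ω ⬝ᵥ M ω *ᵥ Y ω ∂P =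
        ∑ i, ∑ j, (∫ ω, Y ω i * Y ω j ∂P) * ∫ ω, M ω i j ∂P := by
  have hI : ∀ i j, Integrable (fun ω => Y ω i * Y ω j * M ω i j) P := fun i j =>
    (hind i j).integrable_mul (hY i j) (hM i j)
  simp only [dotProduct_mulVec_eq_sum]
  refine ⟨integrable_finsetSum _ fun i _ => integrable_finsetSum _ fun j _ => hI i j, ?_⟩
  rw [integral_finsetSum _ fun i _ => integrable_finsetSum _ fun j _ => hI i j]
  refine Finset.sum_congr rfl fun i _ => ?_
  rw [integral_finsetSum _ fun j _ => hI i j]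
  exact Finset.sum_congr rfl fun j _ =>
    (hind i j).integral_fun_mul_eq_mul_integral (hY i j).1 (hM i j).1

variable {x : Ω → Fin p × Fin n → ℝ}

theorem integrable_comp_hasLaw {E : Type*} [MeasurableSpace E] {μ : Measure E} {y : Ω → E}
    (hy : HasLaw y μ P) {f : E → ℝ} (hf : Integrable f μ) : Integrable (fun ω => f (y ω)) P := by
  rw [← hy.map_eq] at hf
  exact hf.comp_aemeasurable hy.aemeasurable

theorem integrable_integral_colProj [IsProbabilityMeasure P] (hpn : n + 2 ≤ p)
    (hx : HasLaw x (stdGaussianPi (Fin p × Fin n)) P) {Y : Ω → Fin p → ℝ}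
    (hind : IndepFun Y x P) (hY : ∀ i j, Integrable (fun ω => Y ω i * Y ω j) P) :
    Integrable (fun ω => Y ω ⬝ᵥ colProj (toMat (x ω)) *ᵥ Y ω) P ∧
      ∫ ω, Y ω ⬝ᵥ colProj (toMat (x ω)) *ᵥ Y ω ∂P =
        n / p * ∫ ω, Y ω ⬝ᵥ Y ω ∂P := by
  have h := integrable_integral_quadratic (M := fun ω => colProj (toMat (x ω))) (Y := Y) (P := P)
    (fun i j => hind.comp (φ := fun y : Fin p → ℝ => y i * y j) (ψ := fun x => colProj (toMat x) i j)
      ((measurable_pi_apply i).mul (measurable_pi_apply j)) (measurable_colProj_apply i j))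
    hY (fun i j => integrable_comp_hasLaw hx (integrable_colProj_apply i j))
  refine ⟨h.1, h.2.trans ?_⟩
  have hE : ∀ i j, ∫ ω, colProj (toMat (x ω)) i j ∂P = if i = j then (n : ℝ) / p else 0 :=
    fun i j => by
      rw [← integral_colProj_apply hpn i j]
      exact hx.integral_comp (f := fun x => colProj (toMat x) i j)
        (measurable_colProj_apply i j).aestronglyMeasurable
  simp only [hE, dotProduct, mul_ite, mul_zero, Finset.sum_ite_eq, Finset.mem_univ, if_true]
  rw [integral_finsetSum _ fun i _ => hY i i, Finset.mul_sum]
  exact Finset.sum_congr rfl fun i _ => mul_comm _ _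

variable {σ : ℝ≥0} {z : Ω → Fin n → ℝ}

theorem integrable_mul_of_gaussian (hz : ∀ j, HasLaw (fun ω => z ω j) (gaussianReal 0 (σ ^ 2)) P)
    (i j : Fin n) : Integrable (fun ω => z ω i * z ω j) P := by
  have h : ∀ j, MemLp (fun ω => z ω j) 2 P := fun j => by
    have h2 : MemLp id 2 (gaussianReal 0 (σ ^ 2)) := memLp_id_gaussianReal 2
    rw [← (hz j).map_eq] at h2
    exact h2.comp_of_map (hz j).aemeasurable
  exact (h i).integrable_mul (h j)

theorem integral_of_gaussian (hz : ∀ j, HasLaw (fun ω => z ω j) (gaussianReal 0 (σ ^ 2)) P)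
    (j : Fin n) : ∫ ω, z ω j ∂P = 0 :=
  ((hz j).integral_comp (f := id) aestronglyMeasurable_id).trans integral_id_gaussianReal

theorem integral_mul_of_gaussian [IsProbabilityMeasure P] (hz : ∀ j, HasLaw (fun ω => z ω j) (gaussianReal 0 (σ ^ 2)) P)
    (hind : Pairwise fun i j => IndepFun (fun ω => z ω i) (fun ω => z ω j) P) (i j : Fin n) :
    ∫ ω, z ω i * z ω j ∂P = if i = j then (σ : ℝ) ^ 2 else 0 := by
  split_ifs with hij
  · subst hij
    have h := (hz i).integral_comp (f := fun t => t * t)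
      (measurable_id.mul measurable_id).aestronglyMeasurable
    have hv := variance_fun_id_gaussianReal (μ := 0) (v := σ ^ 2)
    rw [variance_of_integral_eq_zero aemeasurable_id' integral_id_gaussianReal] at hv
    refine h.trans ?_
    simpa [sq] using hv
  · rw [(hind hij).integral_fun_mul_eq_mul_integral
      (hz i).aemeasurable.aestronglyMeasurable (hz j).aemeasurable.aestronglyMeasurable,
      integral_of_gaussian hz i, zero_mul]

theorem integrable_integral_noise [IsProbabilityMeasure P] (hpn : n + 2 ≤ p)
    (hx : HasLaw x (stdGaussianPi (Fin p × Fin n)) P)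
    (hz : ∀ j, HasLaw (fun ω => z ω j) (gaussianReal 0 (σ ^ 2)) P)
    (hzz : Pairwise fun i j => IndepFun (fun ω => z ω i) (fun ω => z ω j) P)
    (hzx : IndepFun z x P) :
    Integrable (fun ω => z ω ⬝ᵥ ridgeInv 0 (toMat (x ω)) *ᵥ z ω) P ∧
      ∫ ω, z ω ⬝ᵥ ridgeInv 0 (toMat (x ω)) *ᵥ z ω ∂P = σ ^ 2 *
        ∫ x : Fin p × Fin n → ℝ, (ridgeInv 0 (toMat x)).trace
          ∂stdGaussianPi (Fin p × Fin n) := by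
  have h := integrable_integral_quadratic (M := fun ω => ridgeInv 0 (toMat (x ω))) (Y := z)
    (P := P)
    (fun i j => hzx.comp (φ := fun y : Fin n → ℝ => y i * y j) (ψ := fun x => ridgeInv 0 (toMat x) i j)
      ((measurable_pi_apply i).mul (measurable_pi_apply j)) (measurable_ridgeInv i j))
    (integrable_mul_of_gaussian hz)
    (fun i j => integrable_comp_hasLaw hx (integrable_gramInv_apply hpn i j))
  refine ⟨h.1, h.2.trans ?_⟩
  have hE : ∀ i j, ∫ ω, ridgeInv 0 (toMat (x ω)) i j ∂P =
      ∫ x : Fin p × Fin n → ℝ, ridgeInv 0 (toMat x) i j ∂stdGaussianPi (Fin p × Fin n) :=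
    fun i j => hx.integral_comp (f := fun x => ridgeInv 0 (toMat x) i j)
      (measurable_ridgeInv i j).aestronglyMeasurable
  simp only [integral_mul_of_gaussian hz hzz, hE, ite_mul, zero_mul, Finset.sum_ite_eq,
    Finset.mem_univ, if_true, Matrix.trace, Matrix.diag_apply]
  rw [integral_finsetSum _ fun i _ => integrable_gramInv_apply hpn i i, Finset.mul_sum]

theorem integrable_integral_cross [IsProbabilityMeasure P] (hpn : n + 2 ≤ p)
    (hx : HasLaw x (stdGaussianPi (Fin p × Fin n)) P)
    (hz : ∀ j, HasLaw (fun ω => z ω j) (gaussianReal 0 (σ ^ 2)) P)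
    (hzx : IndepFun z x P) (d : Fin p → ℝ) :
    Integrable (fun ω => d ⬝ᵥ (toMat (x ω) * ridgeInv 0 (toMat (x ω))) *ᵥ z ω) P ∧
      ∫ ω, d ⬝ᵥ (toMat (x ω) * ridgeInv 0 (toMat (x ω))) *ᵥ z ω ∂P = 0 := by
  have hind : ∀ i j, IndepFun (fun ω => (toMat (x ω) * ridgeInv 0 (toMat (x ω))) i j)
      (fun ω => z ω j) P := fun i j =>
    hzx.symm.comp (φ := fun x => (toMat x * ridgeInv 0 (toMat x)) i j) (ψ := fun y : Fin n → ℝ => y j)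
      (measurable_mul_ridgeInv i j) (measurable_pi_apply j)
  have hB : ∀ i j, Integrable (fun ω => (toMat (x ω) * ridgeInv 0 (toMat (x ω))) i j) P :=
    fun i j => integrable_comp_hasLaw hx (integrable_mul_gramInv_apply hpn i j)
  have hzI : ∀ j, Integrable (fun ω => z ω j) P := fun j =>
    integrable_comp_hasLaw (hz j) (f := fun t => t) ((memLp_id_gaussianReal 1).integrable le_rfl)
  have hI : ∀ i j, Integrable
      (fun ω => (toMat (x ω) * ridgeInv 0 (toMat (x ω))) i j * z ω j) P := fun i j =>
    (hind i j).integrable_mul (hB i j) (hzI j)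
  have hI' : ∀ i, Integrable
      (fun ω => d i * ∑ j, (toMat (x ω) * ridgeInv 0 (toMat (x ω))) i j * z ω j) P := fun i =>
    (integrable_finsetSum _ fun j _ => hI i j).const_mul _
  have he : ∀ ω, d ⬝ᵥ (toMat (x ω) * ridgeInv 0 (toMat (x ω))) *ᵥ z ω =
      ∑ i, d i * ∑ j, (toMat (x ω) * ridgeInv 0 (toMat (x ω))) i j * z ω j := fun ω => rfl
  simp only [he]
  refine ⟨integrable_finsetSum _ fun i _ => hI' i, ?_⟩
  rw [integral_finsetSum _ fun i _ => hI' i]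
  refine Finset.sum_eq_zero fun i _ => ?_
  rw [integral_const_mul, integral_finsetSum _ fun j _ => hI i j, Finset.sum_eq_zero, mul_zero]
  intro j _
  rw [(hind i j).integral_fun_mul_eq_mul_integral (hB i j).1 (hzI j).1,
    integral_of_gaussian hz j, mul_zero]

/-- The expected squared error of a model trained from the error `e` on its own task. -/
theorem integrable_integral_stepError [IsProbabilityMeasure P] (hpn : n + 2 ≤ p)
    (hx : HasLaw x (stdGaussianPi (Fin p × Fin n)) P)
    (hz : ∀ j, HasLaw (fun ω => z ω j) (gaussianReal 0 (σ ^ 2)) P)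
    (hzz : Pairwise fun i j => IndepFun (fun ω => z ω i) (fun ω => z ω j) P)
    (hzx : IndepFun z x P) (e : Fin p → ℝ) :
    Integrable (fun ω => stepError (toMat (x ω)) e 0 (z ω) ⬝ᵥ
        stepError (toMat (x ω)) e 0 (z ω)) P ∧
      ∫ ω, stepError (toMat (x ω)) e 0 (z ω) ⬝ᵥ stepError (toMat (x ω)) e 0 (z ω) ∂P =
        (1 - (n : ℝ) / p) * (e ⬝ᵥ e) + σ ^ 2 *
        ∫ x : Fin p × Fin n → ℝ, (ridgeInv 0 (toMat x)).trace
          ∂stdGaussianPi (Fin p × Fin n) := by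
  have h1 := integrable_integral_colProj hpn hx (Y := fun _ => e) (indepFun_const_left e x)
    (fun i j => integrable_const _)
  have h2 := integrable_integral_noise hpn hx hz hzz hzx
  simp only [stepError_dotProduct_self, zero_dotProduct, add_zero, mul_zero]
  have i1 : Integrable (fun ω => e ⬝ᵥ e - e ⬝ᵥ colProj (toMat (x ω)) *ᵥ e) P :=
    (integrable_const _).sub h1.1
  refine ⟨i1.add h2.1, ?_⟩
  rw [integral_add i1 h2.1, integral_sub (integrable_const _) h1.1, h1.2, h2.2]
  simp only [integral_const, probReal_univ, one_smul]
  ring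

theorem measurable_stepError (e d : Fin p → ℝ) :
    Measurable fun q : (Fin p × Fin n → ℝ) × (Fin n → ℝ) => stepError (toMat q.1) e d q.2 := by
  refine measurable_pi_lambda _ fun i => ?_
  have h1 : ∀ e : Fin p → ℝ, Measurable fun q : (Fin p × Fin n → ℝ) × (Fin n → ℝ) =>
      (colProj (toMat q.1) *ᵥ e) i := fun e =>
    Finset.measurable_fun_sum Finset.univ fun k _ =>
      (((measurable_colProj_apply i k).comp measurable_fst).mul_const (e k))
  have h2 : Measurable fun q : (Fin p × Fin n → ℝ) × (Fin n → ℝ) =>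
      ((toMat q.1 * ridgeInv 0 (toMat q.1)) *ᵥ q.2) i :=
    Finset.measurable_fun_sum Finset.univ fun k _ =>
      ((measurable_mul_ridgeInv i k).comp measurable_fst).mul
        ((measurable_pi_apply k).comp measurable_snd)
  exact ((measurable_const.sub (h1 e)).add (h1 d)).add h2

theorem aemeasurable_stepError (hx : AEMeasurable x P) (hz : AEMeasurable z P)
    (e d : Fin p → ℝ) : AEMeasurable (fun ω => stepError (toMat (x ω)) e d (z ω)) P :=
  Measurable.comp_aemeasurable (f := fun ω => (x ω, z ω)) (measurable_stepError e d)
    (hx.prodMk hz)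

theorem indepFun_stepError {E : Type*} [MeasurableSpace E] {y : Ω → E}
    (h : IndepFun (fun ω => (x ω, z ω)) y P) (e d : Fin p → ℝ) :
    IndepFun (fun ω => stepError (toMat (x ω)) e d (z ω)) y P :=
  h.comp (measurable_stepError e d) measurable_id

/-- Lets integrability of `‖e‖²` pass to every product `eᵢ eⱼ`. -/
theorem abs_mul_le_dotProduct_self {ι : Type*} [Fintype ι] (y : ι → ℝ) (i j : ι) :
    |y i * y j| ≤ y ⬝ᵥ y := by
  have h : ∀ k, y k * y k ≤ y ⬝ᵥ y := fun k =>
    Finset.single_le_sum (f := fun k => y k * y k) (fun _ _ => mul_self_nonneg _)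
      (Finset.mem_univ k)
  rw [abs_le]
  constructor <;> nlinarith [h i, h j, sq_nonneg (y i + y j), sq_nonneg (y i - y j)]

end Expectation

/-! ### Laws and independence extracted from the joint data family. -/

section GaussianData

variable {Ω : Type*} [MeasurableSpace Ω] {P : Measure Ω} {p n T : ℕ}
  {σ : ℝ≥0} {X : ℕ → Ω → Matrix (Fin p) (Fin n) ℝ} {z : ℕ → Ω → Fin n → ℝ}

/-- The entries of a random matrix. -/
def entries {Ω : Type*} {p n : ℕ} (X : Ω → Matrix (Fin p) (Fin n) ℝ) (ω : Ω) :
    Fin p × Fin n → ℝ :=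
  fun k => X ω k.1 k.2

theorem toMat_entries {Ω : Type*} {p n : ℕ} (X : Ω → Matrix (Fin p) (Fin n) ℝ) (ω : Ω) :
    toMat (entries X ω) = X ω := rfl

/-- The family of all real random variables in the data. -/
def dataFamily (T : ℕ) (X : ℕ → Ω → Matrix (Fin p) (Fin n) ℝ) (z : ℕ → Ω → Fin n → ℝ) :
    (Finset.Icc 1 T × Fin p × Fin n) ⊕ (Finset.Icc 1 T × Fin n) → Ω → ℝ :=
  Sum.elim (fun k ω => X k.1 ω k.2.1 k.2.2) (fun k ω => z k.1 ω k.2)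

theorem IsGaussianData.aemeasurable (h : IsGaussianData P T σ X z)
    (k : (Finset.Icc 1 T × Fin p × Fin n) ⊕ (Finset.Icc 1 T × Fin n)) :
    AEMeasurable (dataFamily T X z k) P := by
  rcases k with ⟨t, i, j⟩ | ⟨t, j⟩
  · exact (h.law_features t t.2 i j).aemeasurable
  · exact (h.law_noise t t.2 j).aemeasurable

theorem IsGaussianData.iIndepFun_dataFamily (h : IsGaussianData P T σ X z) :
    iIndepFun (dataFamily T X z) P := by
  convert h.indep using 1
  ext k ω
  rcases k with ⟨t, i, j⟩ | ⟨t, j⟩ <;> rfl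

theorem IsGaussianData.hasLaw_entries [IsProbabilityMeasure P] (h : IsGaussianData P T σ X z) {t : ℕ}
    (ht : t ∈ Finset.Icc 1 T) :
    HasLaw (entries (X t)) (stdGaussianPi (Fin p × Fin n)) P := by
  have hm : ∀ k : Fin p × Fin n, AEMeasurable (fun ω => X t ω k.1 k.2) P := fun k =>
    (h.law_features t ht k.1 k.2).aemeasurable
  refine ⟨aemeasurable_pi_lambda _ hm, ?_⟩
  have hi : iIndepFun (fun (k : Fin p × Fin n) ω => X t ω k.1 k.2) P :=
    h.iIndepFun_dataFamily.precomp
      (g := fun k : Fin p × Fin n => Sum.inl ((⟨t, ht⟩ : Finset.Icc 1 T), k.1, k.2))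
      fun k k' hk => by simpa [Prod.ext_iff] using hk
  have := (iIndepFun_iff_map_fun_eq_pi_map hm).1 hi
  refine this.trans ?_
  congr 1
  ext1 k
  exact (h.law_features t ht k.1 k.2).map_eq

theorem IsGaussianData.pairwise_indepFun_noise (h : IsGaussianData P T σ X z) {t : ℕ}
    (ht : t ∈ Finset.Icc 1 T) :
    Pairwise fun i j => IndepFun (fun ω => z t ω i) (fun ω => z t ω j) P := fun i j hij =>
  h.iIndepFun_dataFamily.indepFun (i := Sum.inr (⟨t, ht⟩, i)) (j := Sum.inr (⟨t, ht⟩, j)) (by simpa using hij)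

theorem IsGaussianData.indepFun_noise_entries [IsProbabilityMeasure P] (h : IsGaussianData P T σ X z) {t : ℕ}
    (ht : t ∈ Finset.Icc 1 T) : IndepFun (z t) (entries (X t)) P :=
  h.iIndepFun_dataFamily.indepFun_family h.aemeasurable (fun j : Fin n => Sum.inr (⟨t, ht⟩, j))
    (fun k : Fin p × Fin n => Sum.inl (⟨t, ht⟩, k.1, k.2)) (by simp)

/-- Features and noise of task `s` are kept as a pair because the error after training on it depends
on both. -/
theorem IsGaussianData.indepFun_task_entries [IsProbabilityMeasure P] (h : IsGaussianData P T σ X z) {s t : ℕ}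
    (hs : s ∈ Finset.Icc 1 T) (ht : t ∈ Finset.Icc 1 T) (hst : s ≠ t) :
    IndepFun (fun ω => (entries (X s) ω, z s ω)) (entries (X t)) P := by
  have hi := h.iIndepFun_dataFamily.indepFun_family h.aemeasurable
    (fun k : (Fin p × Fin n) ⊕ Fin n => Sum.elim
      (fun k => Sum.inl ((⟨s, hs⟩ : Finset.Icc 1 T), k.1, k.2))
      (fun j => Sum.inr ((⟨s, hs⟩ : Finset.Icc 1 T), j)) k)
    (fun k : Fin p × Fin n => Sum.inl (⟨t, ht⟩, k.1, k.2)) (by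
      rintro (k | j) k' <;> simp [hst])
  exact hi.comp (φ := fun y : (Fin p × Fin n) ⊕ Fin n → ℝ =>
    ((fun k => y (Sum.inl k), fun j => y (Sum.inr j)) : (Fin p × Fin n → ℝ) × (Fin n → ℝ)))
    (ψ := id)
    ((measurable_pi_lambda _ fun _ => measurable_pi_apply _).prodMk
      (measurable_pi_lambda _ fun _ => measurable_pi_apply _)) measurable_id

end GaussianData
end ContinualLearning

/-! ### The expected forgetting and its sign. -/

open ContinualLearning in
theorem mainTheorem6 {Ω : Type*} [MeasurableSpace Ω] (P : Measure Ω) [IsProbabilityMeasure P]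
    (p n : ℕ) (hpn : n + 2 ≤ p) (σ : ℝ≥0) (wstar : ℕ → EuclideanSpace ℝ (Fin p))
    (X : ℕ → Ω → Matrix (Fin p) (Fin n) ℝ) (z : ℕ → Ω → Fin n → ℝ)
    (hdata : ContinualLearning.IsGaussianData P 2 σ X z)
    (hσ : (σ : ℝ) ^ 2 < ((p : ℝ) - n - 1) / p * ‖wstar 1‖ ^ 2)
    (hw : (n : ℝ) / p * ‖wstar 1‖ ^ 2 + ‖wstar 2‖ ^ 2
        + ((p : ℝ) - n) * (σ : ℝ) ^ 2 / ((p : ℝ) - n - 1)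
      ≤ 2 * inner ℝ (wstar 1) (wstar 2)) :
    Integrable
      (fun ω => ContinualLearning.forgetting wstar (fun t => X t ω) (fun t => z t ω) 2) P ∧
    ∫ ω, ContinualLearning.forgetting wstar (fun t => X t ω) (fun t => z t ω) 2 ∂P ≤ 0 := by
  have m1 : 1 ∈ Finset.Icc 1 2 := by simp
  have m2 : 2 ∈ Finset.Icc 1 2 := by simp
  have hx1 := hdata.hasLaw_entries m1
  have hx2 := hdata.hasLaw_entries m2
  set K : ℝ := ∫ x : Fin p × Fin n → ℝ, (ridgeInv 0 (toMat x)).trace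
    ∂stdGaussianPi (Fin p × Fin n)
  obtain ⟨d, hd⟩ : ∃ d : Fin p → ℝ, d = (wstar 2).ofLp - (wstar 1).ofLp := ⟨_, rfl⟩
  obtain ⟨e, he⟩ : ∃ e : Ω → Fin p → ℝ, e = fun ω =>
    stepError (toMat (entries (X 1) ω)) (-(wstar 1).ofLp) 0 (z 1 ω) := ⟨_, rfl⟩
  have he1 : Integrable (fun ω => e ω ⬝ᵥ e ω) P ∧ ∫ ω, e ω ⬝ᵥ e ω ∂P =
      (1 - (n : ℝ) / p) * (-(wstar 1).ofLp ⬝ᵥ -(wstar 1).ofLp) + σ ^ 2 * K := by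
    rw [he]
    exact integrable_integral_stepError hpn hx1 (hdata.law_noise 1 m1)
      (hdata.pairwise_indepFun_noise m1) (hdata.indepFun_noise_entries m1) _
  have hind : IndepFun e (entries (X 2)) P := by
    rw [he]
    exact indepFun_stepError (hdata.indepFun_task_entries m1 m2 (by norm_num)) _ _
  have hem : AEMeasurable e P := by
    rw [he]
    have hz : AEMeasurable (z 1) P :=
      aemeasurable_pi_lambda _ fun j => (hdata.law_noise 1 m1 j).aemeasurable
    exact aemeasurable_stepError hx1.aemeasurable hz _ _
  have hee : ∀ i j, Integrable (fun ω => e ω i * e ω j) P := fun i j =>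
    he1.1.mono' (((measurable_pi_apply i).comp_aemeasurable hem).mul
      ((measurable_pi_apply j).comp_aemeasurable hem)).aestronglyMeasurable
      (Filter.Eventually.of_forall fun ω => abs_mul_le_dotProduct_self (e ω) i j)
  obtain ⟨x2, hx2'⟩ : ∃ x2, x2 = entries (X 2) := ⟨_, rfl⟩
  rw [← hx2'] at hind hx2
  have hzx2 : IndepFun (z 2) x2 P := hx2' ▸ hdata.indepFun_noise_entries m2
  have t1 : Integrable (fun ω => e ω ⬝ᵥ colProj (toMat (x2 ω)) *ᵥ e ω) P ∧
      ∫ ω, e ω ⬝ᵥ colProj (toMat (x2 ω)) *ᵥ e ω ∂P = n / p * ∫ ω, e ω ⬝ᵥ e ω ∂P :=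
    integrable_integral_colProj hpn hx2 hind hee
  have t2 : Integrable (fun ω => d ⬝ᵥ colProj (toMat (x2 ω)) *ᵥ d) P ∧
      ∫ ω, d ⬝ᵥ colProj (toMat (x2 ω)) *ᵥ d ∂P = n / p * ∫ _, d ⬝ᵥ d ∂P :=
    integrable_integral_colProj hpn hx2 (Y := fun _ => d) (indepFun_const_left d _)
      (fun i j => integrable_const _)
  have t3 : Integrable (fun ω => d ⬝ᵥ (toMat (x2 ω) * ridgeInv 0 (toMat (x2 ω))) *ᵥ z 2 ω) P ∧
      ∫ ω, d ⬝ᵥ (toMat (x2 ω) * ridgeInv 0 (toMat (x2 ω))) *ᵥ z 2 ω ∂P = 0 :=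
    integrable_integral_cross hpn hx2 (hdata.law_noise 2 m2) hzx2 d
  have t4 : Integrable (fun ω => z 2 ω ⬝ᵥ ridgeInv 0 (toMat (x2 ω)) *ᵥ z 2 ω) P ∧
      ∫ ω, z 2 ω ⬝ᵥ ridgeInv 0 (toMat (x2 ω)) *ᵥ z 2 ω ∂P = σ ^ 2 * K :=
    integrable_integral_noise hpn hx2 (hdata.law_noise 2 m2)
      (hdata.pairwise_indepFun_noise m2) hzx2
  -- The formula needs full column rank of both feature matrices, hence holds only almost surely.
  have hae : (fun ω => d ⬝ᵥ colProj (toMat (x2 ω)) *ᵥ d - e ω ⬝ᵥ colProj (toMat (x2 ω)) *ᵥ e ω +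
      2 * (d ⬝ᵥ (toMat (x2 ω) * ridgeInv 0 (toMat (x2 ω))) *ᵥ z 2 ω) +
      z 2 ω ⬝ᵥ ridgeInv 0 (toMat (x2 ω)) *ᵥ z 2 ω) =ᵐ[P]
      fun ω => forgetting wstar (fun t => X t ω) (fun t => z t ω) 2 := by
    have a1 := ae_of_ae_map hx1.aemeasurable (hx1.map_eq.symm ▸ ae_isUnit_gram hpn)
    have a2 := ae_of_ae_map hx2.aemeasurable (hx2.map_eq.symm ▸ ae_isUnit_gram hpn)
    filter_upwards [a1, a2] with ω u1 u2
    rw [hx2'] at u2 ⊢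
    rw [toMat_entries] at u1 u2 ⊢
    exact (forgetting_two_eq wstar (X := fun t => X t ω) (fun t => z t ω) u1 u2
      (congrFun he ω) hd).symm
  have i12 : Integrable (fun ω => d ⬝ᵥ colProj (toMat (x2 ω)) *ᵥ d -
      e ω ⬝ᵥ colProj (toMat (x2 ω)) *ᵥ e ω) P := t2.1.sub t1.1
  have i123 : Integrable (fun ω => d ⬝ᵥ colProj (toMat (x2 ω)) *ᵥ d -
      e ω ⬝ᵥ colProj (toMat (x2 ω)) *ᵥ e ω +
      2 * (d ⬝ᵥ (toMat (x2 ω) * ridgeInv 0 (toMat (x2 ω))) *ᵥ z 2 ω)) P :=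
    i12.add (t3.1.const_mul 2)
  refine ⟨(i123.add t4.1).congr hae, ?_⟩
  rw [← integral_congr_ae hae, integral_add i123 t4.1, integral_add i12 (t3.1.const_mul 2),
    integral_sub t2.1 t1.1, integral_const_mul, t1.2, t2.2, t3.2, t4.2, he1.2]
  simp only [integral_const, probReal_univ, one_smul, neg_dotProduct_neg]
  have n1 : (wstar 1).ofLp ⬝ᵥ (wstar 1).ofLp = ‖wstar 1‖ ^ 2 := by
    rw [← real_inner_self_eq_norm_sq, EuclideanSpace.inner_eq_star_dotProduct, star_trivial]
  have nd : d ⬝ᵥ d = ‖wstar 2‖ ^ 2 - 2 * inner ℝ (wstar 1) (wstar 2) + ‖wstar 1‖ ^ 2 := by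
    rw [hd, real_inner_comm, ← norm_sub_sq_real, ← real_inner_self_eq_norm_sq,
      EuclideanSpace.inner_eq_star_dotProduct, star_trivial, WithLp.ofLp_sub]
  rw [n1, nd]
  have hp : (n : ℝ) + 2 ≤ p := by exact_mod_cast hpn
  have hn0 : (0 : ℝ) ≤ n := n.cast_nonneg
  have hp0 : (0 : ℝ) < p := by linarith
  have hq : (0 : ℝ) < (p : ℝ) - n - 1 := by linarith
  have hKle : K ≤ n / ((p : ℝ) - n - 1) := integral_trace_gramInv_le hpn
  -- The noise of task 2 contributes `σ²K`, and the projected error of task 1 removes `(n/p)σ²K`.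
  -- The net coefficient is nonnegative, so an upper bound on `K` is enough.
  have k1 : (1 - (n : ℝ) / p) * σ ^ 2 * K ≤
      (1 - (n : ℝ) / p) * σ ^ 2 * (n / ((p : ℝ) - n - 1)) := by
    refine mul_le_mul_of_nonneg_left hKle (mul_nonneg ?_ (sq_nonneg _))
    rw [sub_nonneg, div_le_one hp0]
    linarith
  have k2 := mul_le_mul_of_nonneg_left hw (div_nonneg hn0 hp0.le : (0 : ℝ) ≤ n / p)
  -- Rewrites the noise bound as `n/p` times the noise term of the hypothesis.
  have k3 : (1 - (n : ℝ) / p) * σ ^ 2 * (n / ((p : ℝ) - n - 1)) =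
      n / p * (((p : ℝ) - n) * (σ : ℝ) ^ 2 / ((p : ℝ) - n - 1)) := by
    field_simp
  nlinarith [k1, k2, k3]
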